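/- Let $d\ge 1$, $\delta>1$ and $0<\gamma<\frac{\delta}{\delta+1}$. Let $\mathcal X$ be a Poisson process of unit intensity on $\mathbb R^d\times(0,1)$; its points $\mathbf x=(x,t)$ are the vertices, with location $x$ and mark $t$. Let $\mathscr G$ be a random graph given by its conditional laws given the vertex set: for every locally finite $\eta\subset\mathbb R^d\times(0,1)$ let $\mathbb P_\eta$ be the law of a random graph with vertex set $\eta$, depending measurably on $\eta$ (no independence of edges is assumed). Write $\mathbf x\sim\mathbf y$ if $\mathbf x,\mathbf y$ are joined by an edge, and let $\mathrm d(\mathbf x,\mathbf y)\in\mathbb N\cup\{\infty\}$ be the graph distance in $\mathscr G$ (infinite if $\mathbf x,\mathbf y$ are not connected). For $\mathbf x,\mathbf y\in\mathbb R^d\times(0,1)$ let $\mathbb P_{\mathbf x,\mathbf y}=\mathbb E[\mathbb P_{\mathcal X\cup\{\mathbf x,\mathbf y\}}]$ be the law of the graph after adding the vertices $\mathbf x,\mathbf y$ to $\mathcal X$. Assume that there is $\kappa>0$ such that for all $\mathbf x,\mathbf y\in\mathbb R^d\times(0,1)$, for almost every realisation of $\mathcal X$, the vertex set $\eta=\mathcal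 X\cup\{\mathbf x,\mathbf y\}$ satisfies the following: for every finite set $I$ of unordered pairs of distinct vertices of $\eta$ in which each vertex appears at most twice, $$\mathbb P_{\eta}\Big(\bigcap_{\{\mathbf x_i,\mathbf y_i\}\in I}\{\mathbf x_i\sim\mathbf y_i\}\Big)\le\prod_{\{\mathbf x_i,\mathbf y_i\}\in I}\kappa\,(t_i\wedge s_i)^{-\delta\gamma}(t_i\vee s_i)^{\delta(\gamma-1)}|x_i-y_i|^{-\delta d},$$ where $\mathbf x_i=(x_i,t_i)$, $\mathbf y_i=(y_i,s_i)$ (a factor with $x_i=y_i$ is $+\infty$). Then for every $p>1$ there exists $c>0$ such that, for all fixed marks $s,t\in(0,1)$, with $\mathbf x=(x,s)$ and $\mathbf y=(y,t)$, $$\mathbb P_{\mathbf x,\mathbf y}\Big(\mathrm d(\mathbf x,\mathbf y)\ge c\,\frac{\log|x-y|}{(\log\log|x-y|)^p}\Big)\longrightarrow 1\qquad\text{as }|x-y|\to\infty,$$ uniformly over locations $x,y\in\mathbb R^d$ at distance $|x-y|$. -/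

import Mathlib

open MeasureTheory ProbabilityTheory Filter Topology
open scoped ENNReal NNReal

/-- A vertex `(x, t)`: a location `x ∈ ℝ^d` together with a mark `t ∈ (0,1)`. -/
abbrev Vertex (d : ℕ) : Type := EuclideanSpace ℝ (Fin d) × Set.Ioo (0 : ℝ) 1

/-- Lebesgue measure on `ℝ^d × (0,1)`. -/
noncomputable def vertexVolume (d : ℕ) : Measure (Vertex d) :=
  (volume : Measure (EuclideanSpace ℝ (Fin d))).prod
    (Measure.comap (Subtype.val : Set.Ioo (0 : ℝ) 1 → ℝ) volume)

/-- A vertex configuration: a locally finite set of vertices.  (Marks lie in a bounded interval,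
so a set of vertices is bounded exactly when its set of locations is.) -/
structure Configuration (d : ℕ) where
  /-- the set of vertices -/
  carrier : Set (Vertex d)
  locallyFinite : ∀ B : Set (Vertex d), Bornology.IsBounded B → (carrier ∩ B).Finite

/-- The usual σ-algebra on configurations, generated by the numbers of points in measurable
sets. -/
noncomputable instance (d : ℕ) : MeasurableSpace (Configuration d) :=
  ⨆ (B : Set (Vertex d)) (_ : MeasurableSet B),
    MeasurableSpace.comap (fun η : Configuration d => (η.carrier ∩ B).encard) ⊤

/-- The configuration `η ∪ {x}`. -/
def Configuration.addPoint {d : ℕ} (η : Configuration d) (x : Vertex d) : Configuration d where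
  carrier := insert x η.carrier
  locallyFinite := by
    intro B hB
    refine ((η.locallyFinite B hB).insert x).subset ?_
    rintro z ⟨hz | hz, hzB⟩
    · exact Or.inl hz
    · exact Or.inr ⟨hz, hzB⟩

/-- `Λ` is the law of a Poisson process of unit intensity on `ℝ^d × (0,1)`: the number of points in
a measurable set of finite volume is Poisson distributed with mean the volume, and the numbers of
points in disjoint measurable sets are independent. -/
structure IsUnitPoissonLaw {d : ℕ} (Λ : Measure (Configuration d)) : Prop where
  isProbabilityMeasure : IsProbabilityMeasure Λ
  count : ∀ B : Set (Vertex d), MeasurableSet B → vertexVolume d B ≠ ∞ → ∀ k : ℕ,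
    Λ {η | (η.carrier ∩ B).encard = (k : ℕ∞)} = poissonMeasure (vertexVolume d B).toNNReal {k}
  indep : ∀ (n : ℕ) (B : Fin n → Set (Vertex d)), (∀ i, MeasurableSet (B i)) →
    Pairwise (fun i j => Disjoint (B i) (B j)) →
    iIndepFun (m := fun _ => (⊤ : MeasurableSpace ℕ∞))
      (fun (i : Fin n) (η : Configuration d) => (η.carrier ∩ B i).encard) Λ

/-- The σ-algebra on graphs over the space of vertices, generated by the numbers of (ordered) edges
in measurable sets of pairs of vertices, that is, a graph is identified with the point process
of its edges. -/
noncomputable instance (d : ℕ) : MeasurableSpace (SimpleGraph (Vertex d)) :=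
  ⨆ (C : Set (Vertex d × Vertex d)) (_ : MeasurableSet C),
    MeasurableSpace.comap
      (fun G : SimpleGraph (Vertex d) => {p | p ∈ C ∧ G.Adj p.1 p.2}.encard) ⊤

/-- A geometric random graph, given by its conditional laws given the vertex set: `law η` is the law
of the edges when the vertex set is `η`; edges only join points of `η`.  No independence of
edges is required. -/
structure GeometricRandomGraph (d : ℕ) where
  /-- the conditional law of the edges given the vertex set -/
  law : Kernel (Configuration d) (SimpleGraph (Vertex d))
  isMarkov : IsMarkovKernel law
  mem_of_adj : ∀ η : Configuration d, ∀ᵐ G ∂(law η),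
    ∀ x y : Vertex d, G.Adj x y → x ∈ η.carrier ∧ y ∈ η.carrier

/-- The factor `κ (t ∧ s)^{-δγ} (t ∨ s)^{δ(γ-1)} |x - y|^{-δd}` for the vertices `(x,t)` and `(y,s)`,
with value `∞` if `x = y`. -/
noncomputable def edgeFactor {d : ℕ} (κ δ γ : ℝ) (x y : Vertex d) : ℝ≥0∞ :=
  ENNReal.ofReal κ
    * ENNReal.ofReal (min (x.2 : ℝ) (y.2 : ℝ)) ^ (-(δ * γ))
    * ENNReal.ofReal (max (x.2 : ℝ) (y.2 : ℝ)) ^ (δ * (γ - 1))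
    * ENNReal.ofReal ‖x.1 - y.1‖ ^ (-(δ * (d : ℝ)))

open Classical in
/-- The bound on joint edge probabilities for the vertex set `η`: for every finite set `I` of pairs
of distinct points of `η` (each pair listed in one order only) such that each vertex appears at
most twice in `I`, the probability that all pairs in `I` are edges is at most the product of the
edge factors. -/
def GeometricRandomGraph.EdgeBoundAt {d : ℕ} (𝒢 : GeometricRandomGraph d) (κ δ γ : ℝ)
    (η : Configuration d) : Prop :=
  ∀ I : Finset (Vertex d × Vertex d),
    (∀ e ∈ I, e.1 ∈ η.carrier ∧ e.2 ∈ η.carrier) →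
    (∀ e ∈ I, e.swap ∉ I) →
    (∀ v : Vertex d, (I.filter (fun e => e.1 = v)).card + (I.filter (fun e => e.2 = v)).card ≤ 2) →
    𝒢.law η {G | ∀ e ∈ I, G.Adj e.1 e.2} ≤ ∏ e ∈ I, edgeFactor κ δ γ e.1 e.2

/-- The upper bound on edge probabilities with parameters `δ`, `γ`: there is a constant `κ > 0` such
that, whenever two vertices `x`, `y` are added to the Poisson process with law `Λ`, the bound on
joint edge probabilities holds almost surely given the resulting vertex set. -/
def GeometricRandomGraph.EdgeBound {d : ℕ} (𝒢 : GeometricRandomGraph d)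
    (Λ : Measure (Configuration d)) (δ γ : ℝ) : Prop :=
  ∃ κ : ℝ, 0 < κ ∧ ∀ x y : Vertex d, ∀ᵐ η ∂Λ,
    𝒢.EdgeBoundAt κ δ γ ((η.addPoint x).addPoint y)

/-- The probability `ℙ_{x,y}(A)` of an event `A` for the graph whose vertex set is the Poisson
process with law `Λ` to which the vertices `x` and `y` are added. -/
noncomputable def GeometricRandomGraph.palmProb {d : ℕ} (𝒢 : GeometricRandomGraph d)
    (Λ : Measure (Configuration d)) (x y : Vertex d) (A : Set (SimpleGraph (Vertex d))) : ℝ≥0∞ :=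
  ∫⁻ η, 𝒢.law ((η.addPoint x).addPoint y) A ∂Λ

/-! The proof is a first-moment bound over paths. Pairs of vertices whose edge factor is at least
one are added to the graph as edges, which can only shorten distances. A shortest path of the
augmented graph is simple and has no shortcuts: its non-consecutive vertices have edge factor below
one. Given the vertices, such a path is present with probability at most the product of its capped
factors `edgeWeight`, because a simple path meets each vertex in at most two edges.

If the path has interior vertices, the strongest of them (the one of smallest mark) is at distance
at least `‖x - y‖ / 2` from one of the endpoints. It therefore suffices to bound paths from an
endpoint to a far vertex that is the strongest after the start. After its first step, such a path
runs through successive vertices each at least as strong as the one before; between two of these it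
uses weaker vertices only and is split recursively at the strongest of them. The path becomes the
in-order reading of a binary tree.

Two integral estimates make each tree node cost a constant `K`. By `exists_lintegral_connector_le`,
integrating out a weaker vertex between `a` and `b` gives back `K * edgeFactor a b`; this is where
`γ < δ / (δ + 1)` enters. Absence of shortcuts allows this factor to be replaced by `edgeWeight a
b`, so the recursion closes (`lintegral_innerWeight_le`). By `exists_lintegral_stronger_reach_le`,
the function `reach` increases at most by the factor `K` on average under a step to a stronger
vertex (`lintegral_outerWeight_le`).

There are at most `4 ^ n` trees with `n` nodes, so by Campbell's formula and Markov's inequality for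
`reach` the expected weight of paths with at most `N` steps reaching distance `r / 2` is of order `r
^ (-(b * d)) * B ^ N`. For `N` about `log r / (log log r) ^ p`, the factor `B ^ N` is a vanishing
power of `r`, and the bound tends to zero. -/

/-! ### Moments of Poisson counts. -/

section PoissonProcess

variable {d : ℕ}

instance : IsFiniteMeasure (Measure.comap (Subtype.val : Set.Ioo (0 : ℝ) 1 → ℝ) volume) := by
  constructor
  rw [Measure.comap_apply _ Subtype.val_injective
    (fun s hs => (MeasurableEmbedding.subtype_coe measurableSet_Ioo).measurableSet_image.2 hs) _
    MeasurableSet.univ, Set.image_univ, Subtype.range_coe, Real.volume_Ioo]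
  exact ENNReal.ofReal_lt_top

instance : SigmaFinite (vertexVolume d) := by
  unfold vertexVolume; infer_instance

theorem vertexVolume_ne_top_of_isBounded {B : Set (Vertex d)} (hB : Bornology.IsBounded B) :
    vertexVolume d B ≠ ∞ := by
  have h1 : Bornology.IsBounded (Prod.fst '' B) := hB.image_fst
  have h2 : B ⊆ (Prod.fst '' B) ×ˢ Set.univ := fun z hz => ⟨⟨z, hz, rfl⟩, trivial⟩
  refine ((measure_mono h2).trans_lt ?_).ne
  rw [vertexVolume, Measure.prod_prod]
  exact ENNReal.mul_lt_top h1.measure_lt_top (measure_lt_top _ _)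

theorem Configuration.measurable_encard_inter {B : Set (Vertex d)} (hB : MeasurableSet B) :
    Measurable[_, ⊤] (fun η : Configuration d => (η.carrier ∩ B).encard) := by
  rw [measurable_iff_comap_le]
  exact le_iSup₂_of_le B hB le_rfl

theorem Configuration.measurable_count {B : Set (Vertex d)} (hB : MeasurableSet B) :
    Measurable (fun η : Configuration d => ((η.carrier ∩ B).encard : ℝ≥0∞)) :=
  Measurable.comp (g := fun n : ℕ∞ => (n : ℝ≥0∞)) measurable_from_top
    (Configuration.measurable_encard_inter hB)

theorem Configuration.countable_carrier (η : Configuration d) : η.carrier.Countable := by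
  rcases η.carrier.eq_empty_or_nonempty with h | ⟨v, -⟩
  · simp [h]
  · have h : η.carrier = ⋃ n : ℕ, η.carrier ∩ Metric.ball v n := by
      rw [← Set.inter_iUnion, Metric.iUnion_ball_nat, Set.inter_univ]
    rw [h]
    exact Set.countable_iUnion fun n => (η.locallyFinite _ Metric.isBounded_ball).countable

theorem lintegral_cast_poissonMeasure (v : ℝ≥0) :
    ∫⁻ k : ℕ, (k : ℝ≥0∞) ∂(poissonMeasure v) = v := by
  have h1 : ∑' k : ℕ, poissonMeasure v {k} = 1 := by
    have := lintegral_countable' (μ := poissonMeasure v) (fun _ : ℕ => 1)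
    simpa using this.symm
  rw [lintegral_countable', tsum_eq_zero_add' ENNReal.summable]
  have h2 : ∀ k : ℕ, ((k + 1 : ℕ) : ℝ≥0∞) * poissonMeasure v {k + 1}
      = v * poissonMeasure v {k} := by
    intro k
    rw [poissonMeasure_singleton, poissonMeasure_singleton, ← ENNReal.ofReal_natCast,
      ← ENNReal.ofReal_coe_nnreal, ← ENNReal.ofReal_mul (by positivity),
      ← ENNReal.ofReal_mul (by positivity)]
    congr 1
    rw [Nat.factorial_succ]
    push_cast
    field_simp
    ring
  simp_rw [h2, ENNReal.tsum_mul_left, h1]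
  simp

theorem IsUnitPoissonLaw.lintegral_count {Λ : Measure (Configuration d)} (hΛ : IsUnitPoissonLaw Λ)
    {B : Set (Vertex d)} (hB : MeasurableSet B) (hb : Bornology.IsBounded B) :
    ∫⁻ η, ((η.carrier ∩ B).encard : ℝ≥0∞) ∂Λ = vertexVolume d B := by
  have hv := vertexVolume_ne_top_of_isBounded hb
  have hfin : ∀ η : Configuration d, ((η.carrier ∩ B).ncard : ℕ∞) = (η.carrier ∩ B).encard :=
    fun η => (η.locallyFinite B hb).cast_ncard_eq
  have hset : ∀ k : ℕ, (fun η : Configuration d => (η.carrier ∩ B).ncard) ⁻¹' {k}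
      = {η | (η.carrier ∩ B).encard = (k : ℕ∞)} := by
    intro k; ext η
    simp only [Set.mem_preimage, Set.mem_singleton_iff, Set.mem_ofPred_eq, ← hfin]
    norm_cast
  have hm : Measurable (fun η : Configuration d => (η.carrier ∩ B).ncard) := by
    refine measurable_to_countable' fun k => ?_
    rw [hset]
    exact Configuration.measurable_encard_inter hB (MeasurableSpace.measurableSet_top (s := {(k : ℕ∞)}))
  have hmap : Λ.map (fun η : Configuration d => (η.carrier ∩ B).ncard)
      = poissonMeasure (vertexVolume d B).toNNReal := by
    refine Measure.ext_of_singleton fun k => ?_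
    rw [Measure.map_apply hm (measurableSet_singleton k), hset, hΛ.count B hB hv]
  calc ∫⁻ η, ((η.carrier ∩ B).encard : ℝ≥0∞) ∂Λ
      = ∫⁻ η, (((η.carrier ∩ B).ncard : ℕ) : ℝ≥0∞) ∂Λ := by
        refine lintegral_congr fun η => ?_
        rw [← hfin]; simp
    _ = ∫⁻ k : ℕ, (k : ℝ≥0∞) ∂(Λ.map (fun η : Configuration d => (η.carrier ∩ B).ncard)) := by
        rw [lintegral_map measurable_from_top hm]
    _ = _ := by rw [hmap, lintegral_cast_poissonMeasure, ENNReal.coe_toNNReal hv]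

theorem IsUnitPoissonLaw.lintegral_prod_count {Λ : Measure (Configuration d)}
    (hΛ : IsUnitPoissonLaw Λ) {ι : Type*} [Fintype ι] {B : ι → Set (Vertex d)}
    (hB : ∀ i, MeasurableSet (B i)) (hb : ∀ i, Bornology.IsBounded (B i))
    (hd : Pairwise fun i j => Disjoint (B i) (B j)) :
    ∫⁻ η, ∏ i, ((η.carrier ∩ B i).encard : ℝ≥0∞) ∂Λ = ∏ i, vertexVolume d (B i) := by
  have e := Fintype.equivFin ι
  have h1 := hΛ.indep (Fintype.card ι) (fun j => B (e.symm j)) (fun j => hB _)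
    (fun i j hij => hd (e.symm.injective.ne hij))
  have h2 := (h1.comp (fun _ (n : ℕ∞) => (n : ℝ≥0∞)) (fun _ => measurable_from_top)).precomp
    e.injective
  have h3 := lintegral_prod_eq_prod_lintegral_of_indepFun (μ := Λ) Finset.univ
    (fun i (η : Configuration d) => ((η.carrier ∩ B i).encard : ℝ≥0∞))
    (by simpa [Function.comp_def] using h2)
    (fun i => Configuration.measurable_count (hB i))
  rw [h3]
  exact Finset.prod_congr rfl fun i _ => hΛ.lintegral_count (hB i) (hb i)

end PoissonProcess

/-! ### Campbell–Mecke inequality by grid approximation. -/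

section CampbellMecke

variable {d : ℕ} {ι : Type*} [Fintype ι]

/-- The counting measure of the points of a configuration in `B`. -/
noncomputable def Configuration.countIn (η : Configuration d) (B : Set (Vertex d)) :
    Measure (Vertex d) :=
  Measure.count.restrict (η.carrier ∩ B)

theorem Configuration.countIn_apply (η : Configuration d) (B : Set (Vertex d))
    {A : Set (Vertex d)} (hA : MeasurableSet A) :
    η.countIn B A = ((η.carrier ∩ (B ∩ A)).encard : ℝ≥0∞) := by
  rw [countIn, Measure.restrict_apply hA, Set.inter_comm A, Set.inter_assoc]
  refine Measure.count_apply ?_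
  exact (η.countable_carrier.mono Set.inter_subset_left).measurableSet

theorem Configuration.isFiniteMeasure_countIn (η : Configuration d) {B : Set (Vertex d)}
    (hB : Bornology.IsBounded B) : IsFiniteMeasure (η.countIn B) := by
  constructor
  rw [countIn_apply _ _ MeasurableSet.univ, Set.inter_univ]
  have := (η.locallyFinite B hB).encard_lt_top
  simpa using this

theorem Configuration.measurable_pi_countIn {B : ι → Set (Vertex d)}
    (hB : ∀ i, MeasurableSet (B i)) (hb : ∀ i, Bornology.IsBounded (B i)) :
    Measurable fun η : Configuration d => Measure.pi fun i => η.countIn (B i) := by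
  have hf : ∀ (η : Configuration d) i, IsFiniteMeasure (η.countIn (B i)) :=
    fun η i => η.isFiniteMeasure_countIn (hb i)
  have key : ∀ s : ι → Set (Vertex d), (∀ i, MeasurableSet (s i)) →
      Measurable fun η : Configuration d =>
        (Measure.pi fun i => η.countIn (B i)) (Set.univ.pi s) := by
    intro s hs
    simp_rw [Measure.pi_pi]
    refine Finset.measurable_prod _ fun i _ => ?_
    simp_rw [fun η : Configuration d => η.countIn_apply (B i) (hs i)]
    exact measurable_count ((hB i).inter (hs i))
  refine Measurable.measure_of_isPiSystem generateFrom_pi.symm isPiSystem_pi ?_ ?_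
  · rintro _ ⟨s, hs, rfl⟩
    exact key s fun i => hs i trivial
  · simpa using key (fun _ => Set.univ) fun _ => MeasurableSet.univ

/-- On boxes this is independence of the counts in disjoint sets together with their means, and
boxes determine a product measure. -/
theorem IsUnitPoissonLaw.bind_pi_countIn {Λ : Measure (Configuration d)}
    (hΛ : IsUnitPoissonLaw Λ) {B : ι → Set (Vertex d)}
    (hB : ∀ i, MeasurableSet (B i)) (hb : ∀ i, Bornology.IsBounded (B i))
    (hd : Pairwise fun i j => Disjoint (B i) (B j)) :
    Λ.bind (fun η => Measure.pi fun i => η.countIn (B i))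
      = Measure.pi fun i => (vertexVolume d).restrict (B i) := by
  have hf : ∀ (η : Configuration d) i, IsFiniteMeasure (η.countIn (B i)) :=
    fun η i => η.isFiniteMeasure_countIn (hb i)
  symm
  refine Measure.pi_eq fun s hs => ?_
  rw [Measure.bind_apply (MeasurableSet.univ_pi hs)
    (Configuration.measurable_pi_countIn hB hb).aemeasurable]
  simp_rw [Measure.pi_pi, fun (η : Configuration d) i => η.countIn_apply (B i) (hs i)]
  rw [hΛ.lintegral_prod_count (fun i => (hB i).inter (hs i))
    (fun i => (hb i).subset Set.inter_subset_left)
    (fun i j hij => (hd hij).mono Set.inter_subset_left Set.inter_subset_left)]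
  refine Finset.prod_congr rfl fun i _ => ?_
  rw [Measure.restrict_apply (hs i), Set.inter_comm]

/-- The index of the cell of the grid of mesh `1 / (k + 1)` that contains a vertex. -/
noncomputable def gridIndex (k : ℕ) (v : Vertex d) : (Fin d → ℤ) × ℤ :=
  (fun i => ⌊((k : ℝ) + 1) * v.1 i⌋, ⌊((k : ℝ) + 1) * (v.2 : ℝ)⌋)

/-- The cell of the grid of mesh `1 / (k + 1)` with a given index. -/
def gridCell (k : ℕ) (c : (Fin d → ℤ) × ℤ) : Set (Vertex d) := gridIndex k ⁻¹' {c}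

theorem measurable_gridIndex (k : ℕ) : Measurable (gridIndex (d := d) k) := by
  unfold gridIndex
  fun_prop

theorem measurableSet_gridCell (k : ℕ) (c : (Fin d → ℤ) × ℤ) :
    MeasurableSet (gridCell k c) :=
  measurable_gridIndex k (measurableSet_singleton c)

theorem disjoint_gridCell (k : ℕ) {c c' : (Fin d → ℤ) × ℤ} (h : c ≠ c') :
    Disjoint (gridCell k c) (gridCell k c') :=
  Disjoint.preimage _ (by simpa using h)

theorem isBounded_gridCell (k : ℕ) (c : (Fin d → ℤ) × ℤ) :
    Bornology.IsBounded (gridCell k c) := by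
  have h2 : gridCell k c ⊆ (WithLp.ofLp ⁻¹' (Set.Icc (fun i => -(|(c.1 i : ℝ)| + 1))
      (fun i => |(c.1 i : ℝ)| + 1)) : Set (EuclideanSpace ℝ (Fin d))) ×ˢ
        (Set.univ : Set (Set.Ioo (0 : ℝ) 1)) := by
    rintro ⟨x, t⟩ h
    have h' : ∀ i, ⌊((k : ℝ) + 1) * x i⌋ = c.1 i := fun i =>
      congrFun (congrArg Prod.fst (show gridIndex k (x, t) = c from h)) i
    have hb : ∀ i, |x i| ≤ |(c.1 i : ℝ)| + 1 := by
      intro i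
      have h3 := Int.floor_eq_iff.1 (h' i)
      have h4 : |((k : ℝ) + 1) * x i| ≤ |(c.1 i : ℝ)| + 1 := by
        rw [abs_le]
        constructor <;> [linarith [neg_abs_le (c.1 i : ℝ)]; linarith [le_abs_self (c.1 i : ℝ)]]
      rw [abs_mul, abs_of_pos (by positivity)] at h4
      nlinarith [abs_nonneg (x i), (Nat.cast_nonneg k : (0 : ℝ) ≤ k)]
    refine ⟨⟨fun i => (abs_le.1 (hb i)).1, fun i => (abs_le.1 (hb i)).2⟩, trivial⟩
  refine Bornology.IsBounded.subset (Bornology.IsBounded.prod ?_ ?_) h2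
  · exact (PiLp.antilipschitzWith_ofLp 2 _).isBounded_preimage (Metric.isBounded_Icc _ _)
  · refine Metric.isBounded_iff.2 ⟨1, fun x _ y _ => ?_⟩
    rw [Subtype.dist_eq, Real.dist_eq, abs_le]
    constructor <;> linarith [x.2.1, x.2.2, y.2.1, y.2.2]

theorem eventually_gridIndex_ne {v w : Vertex d} (h : v ≠ w) :
    ∀ᶠ k in atTop, gridIndex k v ≠ gridIndex k w := by
  have key : ∀ a b : ℝ, a ≠ b →
      ∀ᶠ k : ℕ in atTop, ⌊((k : ℝ) + 1) * a⌋ ≠ ⌊((k : ℝ) + 1) * b⌋ := by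
    intro a b hab
    obtain ⟨N, hN⟩ := exists_nat_gt (1 / |a - b|)
    filter_upwards [eventually_ge_atTop N] with k hk heq
    have h1 := Int.abs_sub_lt_one_of_floor_eq_floor heq
    rw [← mul_sub, abs_mul, abs_of_pos (by positivity)] at h1
    have h2 : 0 < |a - b| := abs_pos.2 (sub_ne_zero.2 hab)
    rw [div_lt_iff₀ h2] at hN
    have h3 : (N : ℝ) ≤ k := by exact_mod_cast hk
    nlinarith
  by_cases h1 : v.1 = w.1
  · have h2 : (v.2 : ℝ) ≠ w.2 := fun h2 => h (Prod.ext h1 (Subtype.ext h2))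
    filter_upwards [key _ _ h2] with k hk heq
    exact hk (congrArg Prod.snd heq)
  · obtain ⟨i, hi⟩ : ∃ i, v.1 i ≠ w.1 i := by
      by_contra! hc
      exact h1 (by ext i; exact hc i)
    filter_upwards [key _ _ hi] with k hk heq
    exact hk (congrFun (congrArg Prod.fst heq) i)

/-- The labellings of `ι` by distinct points of a configuration. -/
def Configuration.labellings (η : Configuration d) (ι : Type*) : Set (ι → Vertex d) :=
  {x | Function.Injective x ∧ ∀ i, x i ∈ η.carrier}

theorem Configuration.sum_le_lintegral_pi_countIn (η : Configuration d)
    {B : ι → Set (Vertex d)} (hb : ∀ i, Bornology.IsBounded (B i))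
    (S : Finset (ι → Vertex d)) (hS : ∀ x ∈ S, ∀ i, x i ∈ η.carrier ∩ B i)
    (g : (ι → Vertex d) → ℝ≥0∞) :
    ∑ x ∈ S, g x ≤ ∫⁻ x, g x ∂(Measure.pi fun i => η.countIn (B i)) := by
  have hf : ∀ i, IsFiniteMeasure (η.countIn (B i)) :=
    fun i => η.isFiniteMeasure_countIn (hb i)
  refine le_trans ?_ (setLIntegral_le_lintegral (S : Set (ι → Vertex d)) g)
  rw [lintegral_finset]
  refine Finset.sum_le_sum fun x hx => ?_
  have : Measure.pi (fun i => η.countIn (B i)) {x} = 1 := by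
    rw [Measure.pi_singleton]
    refine Finset.prod_eq_one fun i _ => ?_
    rw [countIn_apply _ _ (measurableSet_singleton _)]
    have : η.carrier ∩ (B i ∩ {x i}) = {x i} := by
      rw [← Set.inter_assoc]; exact Set.inter_eq_right.2 (by simpa using hS x hx i)
    rw [this]; simp
  rw [this, mul_one]

/-- The Campbell–Mecke inequality for tuples of distinct points. -/
theorem IsUnitPoissonLaw.exists_tsum_labellings_le {Λ : Measure (Configuration d)}
    (hΛ : IsUnitPoissonLaw Λ) {g : (ι → Vertex d) → ℝ≥0∞} (hg : Measurable g) :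
    ∃ F : Configuration d → ℝ≥0∞, Measurable F ∧
      (∀ η, ∑' x : η.labellings ι, g x ≤ F η) ∧
      ∫⁻ η, F η ∂Λ ≤ ∫⁻ x, g x ∂(Measure.pi fun _ => vertexVolume d) := by
  classical
  -- Only tuples of pairwise distinct cells are summed, so the counts involved are independent. Any
  -- given tuple of distinct points falls into such cells once the mesh is fine enough.
  let J := {c : ι → (Fin d → ℤ) × ℤ // Function.Injective c}
  let F : ℕ → Configuration d → ℝ≥0∞ := fun k η =>
    ∑' c : J, ∫⁻ x, g x ∂(Measure.pi fun i => η.countIn (gridCell k (c.1 i)))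
  have hFm : ∀ k, Measurable (F k) := fun k => Measurable.tsum fun c =>
    (Measure.measurable_lintegral hg).comp (Configuration.measurable_pi_countIn
      (fun i => measurableSet_gridCell k _) (fun i => isBounded_gridCell k _))
  have hFi : ∀ k, ∫⁻ η, F k η ∂Λ ≤ ∫⁻ x, g x ∂(Measure.pi fun _ => vertexVolume d) := by
    intro k
    have hmeas := fun c : J => Configuration.measurable_pi_countIn
      (fun i => measurableSet_gridCell k (c.1 i)) (fun i => isBounded_gridCell k (c.1 i))
    have h0 : ∫⁻ η, F k η ∂Λ = ∑' c : J, ∫⁻ η, ∫⁻ x, g x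
        ∂(Measure.pi fun i => η.countIn (gridCell k (c.1 i))) ∂Λ :=
      lintegral_tsum fun c => ((Measure.measurable_lintegral hg).comp (hmeas c)).aemeasurable
    rw [h0]
    have h1 : ∀ c : J, ∫⁻ η, ∫⁻ x, g x ∂(Measure.pi fun i => η.countIn (gridCell k (c.1 i))) ∂Λ
        = ∫⁻ x in Set.univ.pi fun i => gridCell k (c.1 i), g x
            ∂(Measure.pi fun _ => vertexVolume d) := by
      intro c
      rw [← Measure.lintegral_bind (hmeas c).aemeasurable hg.aemeasurable,
        hΛ.bind_pi_countIn (fun i => measurableSet_gridCell k (c.1 i))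
          (fun i => isBounded_gridCell k (c.1 i))
          (fun i j hij => disjoint_gridCell k (c.2.ne hij)), Measure.restrict_pi_pi]
    simp_rw [h1]
    rw [← lintegral_iUnion (fun c => MeasurableSet.univ_pi fun i => measurableSet_gridCell k _)]
    · exact setLIntegral_le_lintegral _ _
    · intro c c' hcc
      obtain ⟨i, hi⟩ : ∃ i, c.1 i ≠ c'.1 i := by
        by_contra! hc
        exact hcc (Subtype.ext (funext hc))
      exact Set.disjoint_univ_pi.2 ⟨i, disjoint_gridCell k hi⟩
  -- Fatou's lemma bounds the integral of the liminf. This measurable majorant stands in for the sum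
  -- over labellings, whose own measurability is never needed.
  refine ⟨fun η => liminf (fun k => F k η) atTop, Measurable.liminf hFm, fun η => ?_, ?_⟩
  · rw [ENNReal.tsum_eq_iSup_sum]
    refine iSup_le fun S => ?_
    refine le_liminf_of_le (by isBoundedDefault) ?_
    have hev : ∀ᶠ k in atTop, ∀ x ∈ S, Function.Injective fun i => gridIndex k (x.1 i) := by
      refine (Filter.eventually_all_finset S).2 fun x _ => ?_
      have : ∀ᶠ k in atTop, ∀ i j, i ≠ j → gridIndex k (x.1 i) ≠ gridIndex k (x.1 j) := by
        refine eventually_all.2 fun i => eventually_all.2 fun j => ?_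
        by_cases hij : i = j
        · simp [hij]
        · filter_upwards [eventually_gridIndex_ne (x.2.1.ne hij)] with k hk _ using hk
      filter_upwards [this] with k hk i j hij
      by_contra hne
      exact hk i j hne hij
    filter_upwards [hev] with k hk
    let T : Finset (ι → Vertex d) := S.map ⟨Subtype.val, Subtype.val_injective⟩
    let φ : (ι → Vertex d) → (ι → (Fin d → ℤ) × ℤ) := fun x i => gridIndex k (x i)
    have hT : ∀ x ∈ T, (∀ i, x i ∈ η.carrier) ∧ Function.Injective (φ x) := by
      intro x hx
      obtain ⟨y, hy, rfl⟩ := Finset.mem_map.1 hx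
      exact ⟨y.2.2, hk y hy⟩
    have h1 : ∑ x ∈ S, g x = ∑ x ∈ T, g x := by simp [T]
    have h2 : ∑ x ∈ T, g x = ∑ c ∈ T.image φ, ∑ x ∈ T with φ x = c, g x :=
      (Finset.sum_fiberwise_of_maps_to (fun x hx => Finset.mem_image_of_mem φ hx) _).symm
    have h3 : ∀ c ∈ T.image φ, Function.Injective c := by
      intro c hc
      obtain ⟨x, hx, rfl⟩ := Finset.mem_image.1 hc
      exact (hT x hx).2
    rw [h1, h2]
    calc ∑ c ∈ T.image φ, ∑ x ∈ T with φ x = c, g x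
        ≤ ∑ c ∈ T.image φ, ∫⁻ x, g x ∂(Measure.pi fun i => η.countIn (gridCell k (c i))) := by
          refine Finset.sum_le_sum fun c _ => ?_
          refine η.sum_le_lintegral_pi_countIn (fun i => isBounded_gridCell k _) _ ?_ g
          intro x hx i
          obtain ⟨hx, hc⟩ := Finset.mem_filter.1 hx
          exact ⟨(hT x hx).1 i, congrFun hc i⟩
      _ = ∑ c ∈ (T.image φ).subtype Function.Injective,
            ∫⁻ x, g x ∂(Measure.pi fun i => η.countIn (gridCell k (c.1 i))) :=
          (Finset.sum_subtype_of_mem _ h3).symm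
      _ ≤ F k η := ENNReal.sum_le_tsum _
  · calc ∫⁻ η, liminf (fun k => F k η) atTop ∂Λ ≤ liminf (fun k => ∫⁻ η, F k η ∂Λ) atTop :=
        lintegral_liminf_le hFm
      _ ≤ liminf (fun _ : ℕ => ∫⁻ x, g x ∂(Measure.pi fun _ => vertexVolume d)) atTop :=
        liminf_le_liminf (Eventually.of_forall hFi)
      _ = _ := liminf_const _

end CampbellMecke

/-! ### Edge factors and their truncation at one. -/

section EdgeFactor

variable {d : ℕ}

/-- The dependence of the edge factor on the marks. -/
noncomputable def markFactor (κ δ γ s t : ℝ) : ℝ :=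
  κ * min s t ^ (-(δ * γ)) * max s t ^ (δ * (γ - 1))

theorem markFactor_pos {κ δ γ s t : ℝ} (hκ : 0 < κ) (hs : 0 < s) (ht : 0 < t) :
    0 < markFactor κ δ γ s t := by
  have h1 : 0 < min s t := lt_min hs ht
  have h2 : 0 < max s t := lt_max_of_lt_left hs
  unfold markFactor
  positivity

theorem edgeFactor_eq {κ δ γ : ℝ} (hκ : 0 < κ) (x y : Vertex d) :
    edgeFactor κ δ γ x y = ENNReal.ofReal (markFactor κ δ γ x.2 y.2)
      * ENNReal.ofReal ‖x.1 - y.1‖ ^ (-(δ * (d : ℝ))) := by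
  have h1 : 0 < min (x.2 : ℝ) (y.2 : ℝ) := lt_min x.2.2.1 y.2.2.1
  have h2 : 0 < max (x.2 : ℝ) (y.2 : ℝ) := lt_max_of_lt_left x.2.2.1
  rw [edgeFactor, markFactor, ENNReal.ofReal_rpow_of_pos h1, ENNReal.ofReal_rpow_of_pos h2,
    ← ENNReal.ofReal_mul hκ.le, ← ENNReal.ofReal_mul (by positivity)]

theorem edgeFactor_comm (κ δ γ : ℝ) (x y : Vertex d) :
    edgeFactor κ δ γ x y = edgeFactor κ δ γ y x := by
  simp only [edgeFactor, min_comm (x.2 : ℝ), max_comm (x.2 : ℝ), norm_sub_rev x.1]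

theorem edgeFactor_eq_ofReal {κ δ γ : ℝ} (hκ : 0 < κ) {x y : Vertex d} (h : x.1 ≠ y.1) :
    edgeFactor κ δ γ x y
      = ENNReal.ofReal (markFactor κ δ γ x.2 y.2 * ‖x.1 - y.1‖ ^ (-(δ * (d : ℝ)))) := by
  rw [edgeFactor_eq hκ, ENNReal.ofReal_rpow_of_pos (norm_pos_iff.2 (sub_ne_zero.2 h)),
    ← ENNReal.ofReal_mul (markFactor_pos hκ x.2.2.1 y.2.2.1).le]

theorem edgeFactor_eq_top {κ δ γ : ℝ} (hd : 1 ≤ d) (hδ : 0 < δ) (hκ : 0 < κ) {x y : Vertex d}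
    (h : x.1 = y.1) : edgeFactor κ δ γ x y = ∞ := by
  have hd' : (0 : ℝ) < d := by exact_mod_cast hd
  rw [edgeFactor_eq hκ, h, sub_self, norm_zero, ENNReal.ofReal_zero,
    ENNReal.zero_rpow_of_neg (by nlinarith [mul_pos hδ hd']),
    ENNReal.mul_top]
  exact (ENNReal.ofReal_pos.2 (markFactor_pos hκ x.2.2.1 y.2.2.1)).ne'

@[fun_prop]
theorem measurable_edgeFactor {α : Type*} [MeasurableSpace α] {κ δ γ : ℝ} {f g : α → Vertex d}
    (hf : Measurable f) (hg : Measurable g) :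
    Measurable fun a => edgeFactor κ δ γ (f a) (g a) := by
  unfold edgeFactor
  fun_prop

/-- The edge factor, capped at one. -/
noncomputable def edgeWeight (κ δ γ : ℝ) (x y : Vertex d) : ℝ≥0∞ := min 1 (edgeFactor κ δ γ x y)

@[fun_prop]
theorem measurable_edgeWeight {α : Type*} [MeasurableSpace α] {κ δ γ : ℝ} {f g : α → Vertex d}
    (hf : Measurable f) (hg : Measurable g) :
    Measurable fun a => edgeWeight κ δ γ (f a) (g a) := by
  unfold edgeWeight
  fun_prop

theorem edgeWeight_comm (κ δ γ : ℝ) (x y : Vertex d) :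
    edgeWeight κ δ γ x y = edgeWeight κ δ γ y x := by
  rw [edgeWeight, edgeWeight, edgeFactor_comm]

end EdgeFactor

/-! ### Integrals over locations. -/

section SpaceIntegral

theorem measurableSet_mark_le {α : Type*} [MeasurableSpace α] {f g : α → Set.Ioo (0 : ℝ) 1}
    (hf : Measurable f) (hg : Measurable g) : MeasurableSet {a | f a ≤ g a} :=
  measurableSet_le (f := fun a => (f a : ℝ)) (g := fun a => (g a : ℝ)) (by fun_prop) (by fun_prop)

variable {d : ℕ}

/-- The integrand is at most one in the unit ball and decays like `‖w‖ ^ (β - δ * d)` outside it,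
with decay exponent `δ * d - β > d`. -/
theorem lintegral_min_one_norm_rpow_lt_top {δ β : ℝ} (hβ : 0 ≤ β)
    (hβδ : β < (δ - 1) * d) :
    ∫⁻ w : EuclideanSpace ℝ (Fin d), min 1 (ENNReal.ofReal ‖w‖ ^ (-(δ * (d : ℝ))))
      * ENNReal.ofReal ‖w‖ ^ β < ∞ := by
  set e := δ * d - β with he
  have hed : (d : ℝ) < e := by rw [he]; linarith
  have hfin : ∫⁻ w : EuclideanSpace ℝ (Fin d), ENNReal.ofReal ((1 + ‖w‖) ^ (-e)) < ∞ :=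
    finite_integral_one_add_norm (by simpa using hed)
  refine lt_of_le_of_lt (lintegral_mono (g := fun w => ENNReal.ofReal (2 ^ e)
    * ENNReal.ofReal ((1 + ‖w‖) ^ (-e))) fun w => ?_) ?_
  · have h1 : 0 < 1 + ‖w‖ := by positivity
    beta_reduce
    rw [← ENNReal.ofReal_mul (by positivity)]
    have h2 : (2 : ℝ) ^ e * (1 + ‖w‖) ^ (-e) = ((1 + ‖w‖) / 2) ^ (-e) := by
      rw [Real.div_rpow h1.le (by norm_num), Real.rpow_neg (by norm_num : (0:ℝ) ≤ 2)]
      field_simp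
    rw [h2]
    rcases le_or_gt ‖w‖ 1 with hw | hw
    · calc min 1 (ENNReal.ofReal ‖w‖ ^ (-(δ * (d : ℝ)))) * ENNReal.ofReal ‖w‖ ^ β
          ≤ 1 * 1 := by
            refine mul_le_mul' (min_le_left _ _) ?_
            exact ENNReal.rpow_le_one (ENNReal.ofReal_le_one.2 hw) hβ
        _ ≤ ENNReal.ofReal (((1 + ‖w‖) / 2) ^ (-e)) := by
            rw [one_mul, ENNReal.one_le_ofReal]
            exact Real.one_le_rpow_of_pos_of_le_one_of_nonpos (by positivity) (by linarith)
              (by linarith)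
    · calc min 1 (ENNReal.ofReal ‖w‖ ^ (-(δ * (d : ℝ)))) * ENNReal.ofReal ‖w‖ ^ β
          ≤ ENNReal.ofReal ‖w‖ ^ (-(δ * (d : ℝ))) * ENNReal.ofReal ‖w‖ ^ β :=
            mul_le_mul' (min_le_right _ _) le_rfl
        _ = ENNReal.ofReal (‖w‖ ^ (-e)) := by
            have hw0 : 0 < ‖w‖ := by linarith
            rw [ENNReal.ofReal_rpow_of_pos hw0, ENNReal.ofReal_rpow_of_pos hw0,
              ← ENNReal.ofReal_mul (by positivity), ← Real.rpow_add hw0, he]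
            congr 2; ring
        _ ≤ ENNReal.ofReal (((1 + ‖w‖) / 2) ^ (-e)) := by
            refine ENNReal.ofReal_le_ofReal ?_
            exact Real.rpow_le_rpow_of_nonpos (by positivity) (by linarith) (by linarith)
  · rw [lintegral_const_mul _ (by fun_prop)]
    exact ENNReal.mul_lt_top ENNReal.ofReal_lt_top hfin

/-- Rescaling by `a ^ (1 / (δ * d))`, the length at which the cap becomes active, reduces to `a =
1`; the volume and the moment contribute the powers `d` and `β` of this length. -/
theorem exists_lintegral_min_one_le (hd : 1 ≤ d) {δ β : ℝ} (hδ : 1 < δ) (hβ : 0 ≤ β)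
    (hβδ : β < (δ - 1) * d) :
    ∃ C : ℝ≥0∞, C ≠ ∞ ∧ ∀ (a : ℝ) (x : EuclideanSpace ℝ (Fin d)), 0 < a →
      ∫⁻ z, min 1 (ENNReal.ofReal a * ENNReal.ofReal ‖x - z‖ ^ (-(δ * (d : ℝ))))
        * ENNReal.ofReal ‖x - z‖ ^ β ≤ C * ENNReal.ofReal (a ^ ((1 + β / d) / δ)) := by
  have hd' : (0 : ℝ) < d := by exact_mod_cast hd
  refine ⟨_, (lintegral_min_one_norm_rpow_lt_top hβ hβδ).ne, fun a x ha => ?_⟩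
  let F : EuclideanSpace ℝ (Fin d) → ℝ≥0∞ := fun z =>
    min 1 (ENNReal.ofReal a * ENNReal.ofReal ‖z‖ ^ (-(δ * (d : ℝ)))) * ENNReal.ofReal ‖z‖ ^ β
  let F₁ : EuclideanSpace ℝ (Fin d) → ℝ≥0∞ := fun w =>
    min 1 (ENNReal.ofReal ‖w‖ ^ (-(δ * (d : ℝ)))) * ENNReal.ofReal ‖w‖ ^ β
  have hF₁ : Measurable F₁ := by fun_prop
  set ρ : ℝ := a ^ (1 / (δ * d)) with hρ
  have hρ0 : 0 < ρ := Real.rpow_pos_of_pos ha _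
  have hscale : ∀ z, F z = ENNReal.ofReal (ρ ^ β) * F₁ (ρ⁻¹ • z) := by
    intro z
    have hw : ENNReal.ofReal ‖z‖ = ENNReal.ofReal ρ * ENNReal.ofReal ‖ρ⁻¹ • z‖ := by
      rw [← ENNReal.ofReal_mul hρ0.le, norm_smul, norm_inv, Real.norm_of_nonneg hρ0.le,
        mul_inv_cancel_left₀ hρ0.ne']
    have h1 : ENNReal.ofReal ρ ≠ 0 := (ENNReal.ofReal_pos.2 hρ0).ne'
    have h2 : ENNReal.ofReal a * ENNReal.ofReal ρ ^ (-(δ * (d : ℝ))) = 1 := by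
      rw [ENNReal.ofReal_rpow_of_pos hρ0, ← ENNReal.ofReal_mul ha.le, hρ, ← Real.rpow_mul ha.le]
      have : 1 / (δ * d) * -(δ * (d : ℝ)) = -1 := by field_simp
      rw [this, Real.rpow_neg_one, mul_inv_cancel₀ ha.ne', ENNReal.ofReal_one]
    simp only [F, F₁]
    rw [hw, ENNReal.mul_rpow_of_ne_top ENNReal.ofReal_ne_top ENNReal.ofReal_ne_top,
      ENNReal.mul_rpow_of_ne_top ENNReal.ofReal_ne_top ENNReal.ofReal_ne_top, ← mul_assoc (ENNReal.ofReal a), h2,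
      one_mul, ENNReal.ofReal_rpow_of_pos hρ0]
    ring
  have hsmul : ∫⁻ z, F₁ (ρ⁻¹ • z) = ENNReal.ofReal (ρ ^ (d : ℝ)) * ∫⁻ w, F₁ w := by
    have h1 := Measure.map_addHaar_smul (volume : Measure (EuclideanSpace ℝ (Fin d)))
      (inv_ne_zero hρ0.ne')
    have h2 := lintegral_map (μ := volume) hF₁ (measurable_const_smul ρ⁻¹)
    rw [← h2, h1, lintegral_smul_measure, smul_eq_mul]
    congr 2
    rw [finrank_euclideanSpace, Fintype.card_fin, inv_pow, inv_inv, abs_of_pos (by positivity),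
      Real.rpow_natCast]
  calc ∫⁻ z, F (x - z) = ∫⁻ z, F z := lintegral_sub_left_eq_self F x
    _ = ENNReal.ofReal (ρ ^ β) * (ENNReal.ofReal (ρ ^ (d : ℝ)) * ∫⁻ w, F₁ w) := by
        simp_rw [hscale]
        rw [lintegral_const_mul _ (by fun_prop), hsmul]
    _ ≤ (∫⁻ w, F₁ w) * ENNReal.ofReal (a ^ ((1 + β / d) / δ)) := by
        rw [← mul_assoc, mul_comm, ← ENNReal.ofReal_mul (by positivity), ← Real.rpow_add hρ0, hρ,
          ← Real.rpow_mul ha.le]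
        refine le_of_eq ?_
        congr 3
        field_simp
        ring

end SpaceIntegral

/-! ### Integrals over marks. -/

section MarkIntegral

theorem lintegral_mark_rpow_le {e M : ℝ} (he : e < 1) (hM : 0 < M) :
    ∫⁻ t : Set.Ioo (0 : ℝ) 1, (if (t : ℝ) ≤ M then ENNReal.ofReal ((t : ℝ) ^ (-e)) else 0)
      ∂(Measure.comap Subtype.val volume) ≤ ENNReal.ofReal (M ^ (1 - e) / (1 - e)) := by
  have h1 := lintegral_subtype_comap (μ := (volume : Measure ℝ)) (s := Set.Ioo (0 : ℝ) 1)
    measurableSet_Ioo (fun t => if t ≤ M then ENNReal.ofReal (t ^ (-e)) else 0)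
  rw [h1]
  calc ∫⁻ t in Set.Ioo (0 : ℝ) 1, (if t ≤ M then ENNReal.ofReal (t ^ (-e)) else 0)
      ≤ ∫⁻ t in Set.Ioi (0 : ℝ), (if t ≤ M then ENNReal.ofReal (t ^ (-e)) else 0) :=
        lintegral_mono_set Set.Ioo_subset_Ioi_self
    _ = ∫⁻ t in Set.Ioi (0 : ℝ), (Set.Iic M).indicator (fun t => ENNReal.ofReal (t ^ (-e))) t := rfl
    _ = ∫⁻ t in Set.Ioc 0 M, ENNReal.ofReal (t ^ (-e)) := by
        rw [lintegral_indicator measurableSet_Iic, Measure.restrict_restrict measurableSet_Iic,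
          Set.inter_comm, Set.Ioi_inter_Iic]
    _ = ENNReal.ofReal (∫ t in Set.Ioc 0 M, t ^ (-e)) := by
        rw [ofReal_integral_eq_lintegral_ofReal]
        · have := intervalIntegral.intervalIntegrable_rpow' (a := 0) (b := M) (r := -e) (by linarith)
          exact (intervalIntegrable_iff_integrableOn_Ioc_of_le hM.le).1 this
        · filter_upwards [ae_restrict_mem measurableSet_Ioc] with t ht
          exact Real.rpow_nonneg ht.1.le _
    _ = ENNReal.ofReal (M ^ (1 - e) / (1 - e)) := by
        rw [← intervalIntegral.integral_of_le hM.le, integral_rpow (Or.inl (by linarith)),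
          Real.zero_rpow (by linarith), sub_zero, neg_add_eq_sub]
    _ ≤ _ := le_rfl

theorem lintegral_mark_rpow_ge {e M : ℝ} (he : 1 < e) (hM : 0 < M) :
    ∫⁻ t : Set.Ioo (0 : ℝ) 1, (if M ≤ (t : ℝ) then ENNReal.ofReal ((t : ℝ) ^ (-e)) else 0)
      ∂(Measure.comap Subtype.val volume) ≤ ENNReal.ofReal (M ^ (1 - e) / (e - 1)) := by
  have h1 := lintegral_subtype_comap (μ := (volume : Measure ℝ)) (s := Set.Ioo (0 : ℝ) 1)
    measurableSet_Ioo (fun t => if M ≤ t then ENNReal.ofReal (t ^ (-e)) else 0)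
  rw [h1]
  calc ∫⁻ t in Set.Ioo (0 : ℝ) 1, (if M ≤ t then ENNReal.ofReal (t ^ (-e)) else 0)
      ≤ ∫⁻ t, (if M ≤ t then ENNReal.ofReal (t ^ (-e)) else 0) := setLIntegral_le_lintegral _ _
    _ = ∫⁻ t, (Set.Ici M).indicator (fun t => ENNReal.ofReal (t ^ (-e))) t := rfl
    _ = ∫⁻ t in Set.Ioi M, ENNReal.ofReal (t ^ (-e)) := by
        rw [lintegral_indicator measurableSet_Ici, restrict_Ioi_eq_restrict_Ici]
    _ = ENNReal.ofReal (∫ t in Set.Ioi M, t ^ (-e)) := by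
        rw [ofReal_integral_eq_lintegral_ofReal]
        · exact integrableOn_Ioi_rpow_of_lt (by linarith) hM
        · filter_upwards [ae_restrict_mem measurableSet_Ioi] with t ht
          exact Real.rpow_nonneg (hM.trans ht).le _
    _ = ENNReal.ofReal (M ^ (1 - e) / (e - 1)) := by
        rw [integral_Ioi_rpow_of_lt (by linarith) hM, neg_add_eq_sub, ← neg_div_neg_eq]
        congr 2 <;> ring_nf
    _ ≤ _ := le_rfl

end MarkIntegral

/-! ### Integrating out a weaker vertex between two vertices. -/

section Connectors

variable {d : ℕ}

theorem edgeWeight_le_edgeFactor (κ δ γ : ℝ) (x y : Vertex d) :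
    edgeWeight κ δ γ x y ≤ edgeFactor κ δ γ x y :=
  min_le_right _ _

theorem edgeWeight_le_ofReal_of_le {κ δ γ r : ℝ} (hδ : 0 < δ) (hκ : 0 < κ) (hr : 0 < r)
    {x y : Vertex d} (h : r ≤ ‖x.1 - y.1‖) :
    edgeWeight κ δ γ x y
      ≤ ENNReal.ofReal (markFactor κ δ γ x.2 y.2 * r ^ (-(δ * (d : ℝ)))) := by
  have hne : x.1 ≠ y.1 := fun h0 => by simp [h0] at h; linarith
  refine (edgeWeight_le_edgeFactor _ _ _ _ _).trans ?_
  rw [edgeFactor_eq_ofReal hκ hne]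
  refine ENNReal.ofReal_le_ofReal (mul_le_mul_of_nonneg_left ?_
    (markFactor_pos hκ x.2.2.1 y.2.2.1).le)
  exact Real.rpow_le_rpow_of_nonpos hr h (by nlinarith [mul_nonneg hδ.le (Nat.cast_nonneg (α := ℝ) d)])

theorem rpow_mul_rpow_le_min_mul_max {s t p q : ℝ} (hs : 0 < s) (ht : 0 < t) (hpq : q ≤ p) :
    s ^ (-p) * t ^ (-q) ≤ min s t ^ (-p) * max s t ^ (-q) := by
  rcases le_total s t with h | h
  · rw [min_eq_left h, max_eq_right h]
  · rw [min_eq_right h, max_eq_left h]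
    have h1 : s ^ (-p) = s ^ (-q) * s ^ (-(p - q)) := by rw [← Real.rpow_add hs]; congr 1; ring
    have h2 : t ^ (-p) = t ^ (-q) * t ^ (-(p - q)) := by rw [← Real.rpow_add ht]; congr 1; ring
    have h3 : s ^ (-(p - q)) ≤ t ^ (-(p - q)) :=
      Real.rpow_le_rpow_of_nonpos ht h (by linarith)
    have h4 : 0 ≤ s ^ (-q) * t ^ (-q) := by positivity
    rw [h1, h2]
    nlinarith

theorem rpow_inv_markFactor {κ δ γ s t e : ℝ} (hδ : 0 < δ) (hκ : 0 < κ) (hs : 0 < s)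
    (ht : 0 < t) : markFactor κ δ γ s t ^ (e / δ)
      = κ ^ (e / δ) * min s t ^ (-(γ * e)) * max s t ^ ((γ - 1) * e) := by
  have h1 : 0 < min s t := lt_min hs ht
  have h2 : 0 < max s t := lt_max_of_lt_left hs
  rw [markFactor, Real.mul_rpow (by positivity) (by positivity),
    Real.mul_rpow hκ.le (by positivity), ← Real.rpow_mul h1.le, ← Real.rpow_mul h2.le]
  congr 2
  · congr 1; field_simp
  · field_simp

/-- Connecting two vertices through a weaker one is not more likely, up to a constant, than the
bound on the probability of connecting them directly. -/
theorem exists_lintegral_connector_le (hd : 1 ≤ d) {κ δ γ : ℝ} (hκ : 0 < κ) (hδ : 1 < δ)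
    (hγ₀ : 0 < γ) (hγ : γ < δ / (δ + 1)) :
    ∃ K : ℝ≥0∞, K ≠ ∞ ∧ ∀ a b : Vertex d,
      ∫⁻ u, (if a.2 ≤ u.2 ∧ b.2 ≤ u.2 then edgeWeight κ δ γ a u * edgeWeight κ δ γ u b else 0)
        ∂(vertexVolume d) ≤ K * edgeFactor κ δ γ a b := by
  have hd' : (0 : ℝ) < d := by exact_mod_cast hd
  have hδ0 : 0 < δ := by linarith
  have hγ1 : γ * (δ + 1) < δ := (lt_div_iff₀ (by linarith)).1 hγ
  obtain ⟨C, hC, hCi⟩ := exists_lintegral_min_one_le hd hδ le_rfl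
    (show (0 : ℝ) < (δ - 1) * d from mul_pos (by linarith) hd')
  simp only [ENNReal.rpow_zero, mul_one, zero_div, add_zero] at hCi
  -- After integration over the location, the mark `v` of the connector enters as `v ^ (-e)`. The
  -- condition `1 < e` is exactly `γ < δ / (δ + 1)` and makes marks near the stronger bound `M`
  -- dominate.
  set e : ℝ := (1 - γ) * (1 + δ) with he
  have he1 : 1 < e := by rw [he]; nlinarith
  set c₀ : ℝ := κ ^ (1 / δ) * 2 ^ (δ * d) / (e - 1) with hc₀
  have hc₀0 : 0 < c₀ := div_pos (by positivity) (by linarith)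
  -- The summand one keeps the constant nonzero, so that its product with the factor `∞` of
  -- coinciding locations is `∞`.
  refine ⟨C * 2 * ENNReal.ofReal c₀ + 1, by finiteness, fun a b => ?_⟩
  by_cases hab : a.1 = b.1
  · rw [edgeFactor_eq_top hd hδ0 hκ hab, ENNReal.mul_top (by simp)]
    exact le_top
  set D : ℝ := ‖a.1 - b.1‖ with hD
  have hD0 : 0 < D := norm_pos_iff.2 (sub_ne_zero.2 hab)
  obtain ⟨x, s⟩ := a
  obtain ⟨y, t⟩ := b
  simp only at hab hD ⊢
  have hs := s.2.1
  have ht := t.2.1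
  set m : ℝ := min (s : ℝ) t with hm
  set M : ℝ := max (s : ℝ) t with hM
  have hm0 : 0 < m := lt_min hs ht
  have hM0 : 0 < M := lt_max_of_lt_left hs
  have hmeas : Measurable fun u : Vertex d => (if s ≤ u.2 ∧ t ≤ u.2 then
      edgeWeight κ δ γ (x, s) u * edgeWeight κ δ γ u (y, t) else 0) := by
    refine Measurable.ite ?_ (by fun_prop) measurable_const
    exact (measurableSet_mark_le measurable_const measurable_snd).inter
      (measurableSet_mark_le measurable_const measurable_snd)
  have hspace : ∀ (a : Vertex d) (v : Set.Ioo (0 : ℝ) 1),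
      ∫⁻ z, edgeWeight κ δ γ a (z, v)
        ≤ C * ENNReal.ofReal (markFactor κ δ γ a.2 v ^ (1 / δ)) := by
    intro a v
    refine le_trans (le_of_eq ?_) (hCi _ a.1 (markFactor_pos hκ a.2.2.1 v.2.1))
    refine lintegral_congr fun z => ?_
    rw [edgeWeight, edgeFactor_eq hκ]
  set A : ℝ := κ ^ (1 + 1 / δ) * (D / 2) ^ (-(δ * d)) * (m ^ (-(δ * γ)) * M ^ (-γ)) with hA
  have hA0 : 0 < A := by positivity
  have hmf : ∀ r : ℝ, 0 < r → ∀ v : ℝ, 0 < v → r ≤ v →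
      markFactor κ δ γ r v = κ * r ^ (-(δ * γ)) * v ^ (δ * (γ - 1)) := by
    intro r hr v hv hrv
    rw [markFactor, min_eq_left hrv, max_eq_right hrv]
  -- Here `r` is the mark of the endpoint of the long edge, whose factor is bounded by its length `D
  -- / 2`, and `q` that of the endpoint of the edge integrated over space. Since `γ ≤ δ * γ`, the
  -- worst case is that `r` is the smaller mark.
  have halg : ∀ r q v : ℝ, 0 < r → 0 < q → r ≤ v → q ≤ v →
      min r q = m → max r q = M →
      markFactor κ δ γ r v * (D / 2) ^ (-(δ * (d : ℝ))) * markFactor κ δ γ q v ^ (1 / δ)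
        ≤ A * v ^ (-e) := by
    intro r q v hr hq hrv hqv hrm hrM
    have hv : 0 < v := hr.trans_le hrv
    rw [rpow_inv_markFactor hδ0 hκ hq hv, hmf r hr v hv hrv, min_eq_left hqv, max_eq_right hqv]
    have h1 := rpow_mul_rpow_le_min_mul_max hr hq (show γ ≤ δ * γ by nlinarith)
    rw [hrm, hrM] at h1
    have h2 : v ^ (-e) = v ^ (δ * (γ - 1)) * v ^ ((γ - 1) * 1) := by
      rw [← Real.rpow_add hv, he]; congr 1; ring
    have h3 : κ ^ (1 + 1 / δ) = κ * κ ^ (1 / δ) := by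
      rw [Real.rpow_add hκ, Real.rpow_one]
    rw [hA, h2, h3, mul_one, mul_one]
    have h4 : 0 ≤ κ * κ ^ (1 / δ) * (D / 2) ^ (-(δ * (d : ℝ)))
        * (v ^ (δ * (γ - 1)) * v ^ (γ - 1)) := by positivity
    calc _ = κ * κ ^ (1 / δ) * (D / 2) ^ (-(δ * (d : ℝ)))
        * (v ^ (δ * (γ - 1)) * v ^ (γ - 1)) * (r ^ (-(δ * γ)) * q ^ (-γ)) := by ring
      _ ≤ κ * κ ^ (1 / δ) * (D / 2) ^ (-(δ * (d : ℝ)))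
        * (v ^ (δ * (γ - 1)) * v ^ (γ - 1)) * (m ^ (-(δ * γ)) * M ^ (-γ)) :=
          mul_le_mul_of_nonneg_left h1 h4
      _ = _ := by ring
  have hinner : ∀ v : Set.Ioo (0 : ℝ) 1,
      ∫⁻ z, (if s ≤ v ∧ t ≤ v then
        edgeWeight κ δ γ (x, s) (z, v) * edgeWeight κ δ γ (z, v) (y, t) else 0)
      ≤ C * 2 * ENNReal.ofReal A *
        (if M ≤ (v : ℝ) then ENNReal.ofReal ((v : ℝ) ^ (-e)) else 0) := by
    intro v
    by_cases hv : s ≤ v ∧ t ≤ v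
    · have hvM : M ≤ (v : ℝ) := max_le hv.1 hv.2
      simp only [hv, and_self, if_true, hvM]
      set P := ENNReal.ofReal (markFactor κ δ γ s v * (D / 2) ^ (-(δ * (d : ℝ))))
      set Q := ENNReal.ofReal (markFactor κ δ γ t v * (D / 2) ^ (-(δ * (d : ℝ))))
      -- One of the two edges has length at least `D / 2`; the other one is kept for the integration
      -- over `z`.
      have hpt : ∀ z, edgeWeight κ δ γ (x, s) (z, v) * edgeWeight κ δ γ (z, v) (y, t)
          ≤ P * edgeWeight κ δ γ (y, t) (z, v) + Q * edgeWeight κ δ γ (x, s) (z, v) := by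
        intro z
        rw [edgeWeight_comm _ _ _ (z, v) (y, t)]
        have htri : D ≤ ‖x - z‖ + ‖y - z‖ := by
          rw [hD, norm_sub_rev y z]; exact norm_sub_le_norm_sub_add_norm_sub x z y
        rcases le_or_gt (D / 2) ‖x - z‖ with h | h
        · refine le_trans (mul_le_mul' (edgeWeight_le_ofReal_of_le hδ0 hκ (half_pos hD0) ?_)
            le_rfl) le_self_add
          exact h
        · rw [mul_comm]
          refine le_trans (mul_le_mul' (edgeWeight_le_ofReal_of_le hδ0 hκ (half_pos hD0) ?_)
            le_rfl) le_add_self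
          show D / 2 ≤ ‖y - z‖
          linarith
      calc ∫⁻ z, edgeWeight κ δ γ (x, s) (z, v) * edgeWeight κ δ γ (z, v) (y, t)
          ≤ ∫⁻ z, (P * edgeWeight κ δ γ (y, t) (z, v) + Q * edgeWeight κ δ γ (x, s) (z, v)) :=
            lintegral_mono hpt
        _ = P * (∫⁻ z, edgeWeight κ δ γ (y, t) (z, v))
            + Q * ∫⁻ z, edgeWeight κ δ γ (x, s) (z, v) := by
            rw [lintegral_add_left (by fun_prop), lintegral_const_mul _ (by fun_prop),
              lintegral_const_mul _ (by fun_prop)]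
        _ ≤ P * (C * ENNReal.ofReal (markFactor κ δ γ t v ^ (1 / δ)))
            + Q * (C * ENNReal.ofReal (markFactor κ δ γ s v ^ (1 / δ))) := by
            exact add_le_add (mul_le_mul' le_rfl (hspace _ _)) (mul_le_mul' le_rfl (hspace _ _))
        _ ≤ C * ENNReal.ofReal (A * (v : ℝ) ^ (-e)) + C * ENNReal.ofReal (A * (v : ℝ) ^ (-e)) := by
            have hpos := fun q : Set.Ioo (0 : ℝ) 1 => (markFactor_pos (δ := δ) (γ := γ) hκ q.2.1 v.2.1).le
            refine add_le_add ?_ ?_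
            · rw [mul_left_comm, ← ENNReal.ofReal_mul (mul_nonneg (hpos s) (by positivity))]
              exact mul_le_mul' le_rfl (ENNReal.ofReal_le_ofReal
                (halg s t v hs ht hv.1 hv.2 rfl rfl))
            · rw [mul_left_comm, ← ENNReal.ofReal_mul (mul_nonneg (hpos t) (by positivity))]
              exact mul_le_mul' le_rfl (ENNReal.ofReal_le_ofReal
                (halg t s v ht hs hv.2 hv.1 (min_comm _ _) (max_comm _ _)))
        _ = _ := by rw [ENNReal.ofReal_mul hA0.le]; ring
    · simp [hv]
  calc _ = ∫⁻ v, ∫⁻ z, (if s ≤ v ∧ t ≤ v then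
        edgeWeight κ δ γ (x, s) (z, v) * edgeWeight κ δ γ (z, v) (y, t) else 0)
        ∂volume ∂(Measure.comap Subtype.val volume) := by
        rw [vertexVolume, lintegral_prod_symm _ hmeas.aemeasurable]
    _ ≤ ∫⁻ v : Set.Ioo (0 : ℝ) 1, C * 2 * ENNReal.ofReal A *
        (if M ≤ (v : ℝ) then ENNReal.ofReal ((v : ℝ) ^ (-e)) else 0)
          ∂(Measure.comap Subtype.val volume) := lintegral_mono hinner
    _ ≤ C * 2 * ENNReal.ofReal A * ENNReal.ofReal (M ^ (1 - e) / (e - 1)) := by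
        rw [lintegral_const_mul _ (Measurable.ite (measurableSet_le measurable_const
          measurable_subtype_coe) (by fun_prop) measurable_const)]
        gcongr
        exact lintegral_mark_rpow_ge he1 hM0
    _ = C * 2 * ENNReal.ofReal c₀ * edgeFactor κ δ γ (x, s) (y, t) := by
        rw [edgeFactor_eq_ofReal hκ hab, mul_assoc _ (ENNReal.ofReal A),
          mul_assoc _ (ENNReal.ofReal c₀), ← ENNReal.ofReal_mul hA0.le,
          ← ENNReal.ofReal_mul hc₀0.le]
        congr 2
        -- The power `-γ` from the short edge and `1 - e` from the mark integral add up exactly to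
        -- the exponent of the larger mark in the edge factor.
        have h2 : M ^ (δ * (γ - 1)) = M ^ (-γ) * M ^ (1 - e) := by
          rw [← Real.rpow_add hM0, he]; congr 1; ring
        have h3 : κ ^ (1 + 1 / δ) = κ * κ ^ (1 / δ) := by
          rw [Real.rpow_add hκ, Real.rpow_one]
        have h4 : (D / 2) ^ (-(δ * (d : ℝ))) = D ^ (-(δ * (d : ℝ))) * 2 ^ (δ * d) := by
          rw [Real.div_rpow hD0.le (by norm_num), Real.rpow_neg (by norm_num : (0 : ℝ) ≤ 2),
            div_inv_eq_mul]
        have h5 : e - 1 ≠ 0 := by linarith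
        simp only [hA, hc₀, markFactor]
        rw [h3, h4, ← hm, ← hM, ← hD, h2]
        field_simp
    _ ≤ _ := by gcongr; exact le_self_add

end Connectors

/-! ### How `reach` grows along a step. -/

section Reach

variable {d : ℕ}

/-- A weight of the vertex `u`, large if `u` is far from `x` or has a small mark. -/
noncomputable def reach (b : ℝ) (x : EuclideanSpace ℝ (Fin d)) (u : Vertex d) : ℝ≥0∞ :=
  ENNReal.ofReal ‖x - u.1‖ ^ (b * d) + ENNReal.ofReal ((u.2 : ℝ) ^ (-b))

@[fun_prop]
theorem measurable_reach {α : Type*} [MeasurableSpace α] {b : ℝ} {x : EuclideanSpace ℝ (Fin d)}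
    {f : α → Vertex d} (hf : Measurable f) : Measurable fun a => reach b x (f a) := by
  unfold reach
  fun_prop

theorem edgeWeight_le_of_markFactor_le {κ δ γ A : ℝ} (hκ : 0 < κ) {a u : Vertex d}
    (hA : markFactor κ δ γ a.2 u.2 ≤ A) :
    edgeWeight κ δ γ a u
      ≤ min 1 (ENNReal.ofReal A * ENNReal.ofReal ‖a.1 - u.1‖ ^ (-(δ * (d : ℝ)))) := by
  rw [edgeWeight, edgeFactor_eq hκ]
  gcongr

/-- Since `b * d ≤ 1`, the power of the distance is subadditive and `reach` splits into a part at
`a`, the mark term, and a moment of the jump from `a`. That moment is finite because `b < δ - 1`. -/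
theorem exists_lintegral_location_reach_le (hd : 1 ≤ d) {κ δ γ b : ℝ} (hκ : 0 < κ) (hδ : 1 < δ)
    (hb : 0 < b) (hbd : b * d ≤ 1) (hbδ : b < δ - 1) :
    ∃ C : ℝ≥0∞, C ≠ ∞ ∧ ∀ (x : EuclideanSpace ℝ (Fin d)) (a : Vertex d) (t : Set.Ioo (0 : ℝ) 1)
      (A : ℝ), markFactor κ δ γ a.2 t ≤ A →
      ∫⁻ z, edgeWeight κ δ γ a (z, t) * reach b x (z, t)
        ≤ C * (ENNReal.ofReal (A ^ (1 / δ)) * ENNReal.ofReal ‖x - a.1‖ ^ (b * d)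
          + ENNReal.ofReal (A ^ (1 / δ)) * ENNReal.ofReal ((t : ℝ) ^ (-b))
          + ENNReal.ofReal (A ^ ((1 + b) / δ))) := by
  have hd' : (0 : ℝ) < d := by exact_mod_cast hd
  obtain ⟨C₁, hC₁, h₁⟩ := exists_lintegral_min_one_le hd hδ le_rfl
    (show (0 : ℝ) < (δ - 1) * d from mul_pos (by linarith) hd')
  obtain ⟨C₂, hC₂, h₂⟩ := exists_lintegral_min_one_le hd hδ (by positivity : 0 ≤ b * d)
    (mul_lt_mul_of_pos_right hbδ hd')
  simp only [ENNReal.rpow_zero, mul_one, zero_div, add_zero] at h₁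
  rw [mul_div_cancel_right₀ _ hd'.ne'] at h₂
  refine ⟨C₁ + C₂, by finiteness, fun x a t A hA => ?_⟩
  have hA0 : 0 < A := (markFactor_pos hκ a.2.2.1 t.2.1).trans_le hA
  set X := ENNReal.ofReal ‖x - a.1‖ ^ (b * d)
  set T := ENNReal.ofReal ((t : ℝ) ^ (-b))
  let ψ : EuclideanSpace ℝ (Fin d) → ℝ≥0∞ := fun z =>
    min 1 (ENNReal.ofReal A * ENNReal.ofReal ‖a.1 - z‖ ^ (-(δ * (d : ℝ))))
  have hpt : ∀ z, edgeWeight κ δ γ a (z, t) * reach b x (z, t)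
      ≤ (X + T) * ψ z + ψ z * ENNReal.ofReal ‖a.1 - z‖ ^ (b * d) := by
    intro z
    have h3 : ENNReal.ofReal ‖x - z‖ ^ (b * d) ≤ X + ENNReal.ofReal ‖a.1 - z‖ ^ (b * d) := by
      refine le_trans ?_ (ENNReal.rpow_add_le_add_rpow _ _ (by positivity) hbd)
      rw [← ENNReal.ofReal_add (norm_nonneg _) (norm_nonneg _)]
      exact ENNReal.rpow_le_rpow (ENNReal.ofReal_le_ofReal
        (norm_sub_le_norm_sub_add_norm_sub _ _ _)) (by positivity)
    calc edgeWeight κ δ γ a (z, t) * reach b x (z, t)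
        ≤ ψ z * ((X + ENNReal.ofReal ‖a.1 - z‖ ^ (b * d)) + T) :=
          mul_le_mul' (edgeWeight_le_of_markFactor_le hκ hA) (add_le_add h3 le_rfl)
      _ = _ := by ring
  calc _ ≤ ∫⁻ z, ((X + T) * ψ z + ψ z * ENNReal.ofReal ‖a.1 - z‖ ^ (b * d)) := lintegral_mono hpt
    _ = (X + T) * (∫⁻ z, ψ z) + ∫⁻ z, ψ z * ENNReal.ofReal ‖a.1 - z‖ ^ (b * d) := by
        rw [lintegral_add_left (by fun_prop), lintegral_const_mul _ (by fun_prop)]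
    _ ≤ (X + T) * (C₁ * ENNReal.ofReal (A ^ (1 / δ)))
        + C₂ * ENNReal.ofReal (A ^ ((1 + b) / δ)) :=
        add_le_add (mul_le_mul' le_rfl (h₁ A a.1 hA0)) (h₂ A a.1 hA0)
    _ = C₁ * (ENNReal.ofReal (A ^ (1 / δ)) * X + ENNReal.ofReal (A ^ (1 / δ)) * T)
        + C₂ * ENNReal.ofReal (A ^ ((1 + b) / δ)) := by ring
    _ ≤ (C₁ + C₂) * (ENNReal.ofReal (A ^ (1 / δ)) * X + ENNReal.ofReal (A ^ (1 / δ)) * T)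
        + (C₁ + C₂) * ENNReal.ofReal (A ^ ((1 + b) / δ)) := by
        gcongr
        · exact le_self_add
        · exact le_add_self
    _ = _ := by ring

theorem measurable_mark_ite (e M : ℝ) : Measurable fun t : Set.Ioo (0 : ℝ) 1 =>
    (if (t : ℝ) ≤ M then ENNReal.ofReal ((t : ℝ) ^ (-e)) else 0) :=
  Measurable.ite (measurableSet_le measurable_subtype_coe measurable_const) (by fun_prop)
    measurable_const

/-- From a vertex of mark `s`, edges to vertices of comparable mark have length of order `s ^ (-1 /
d)`. Such a jump adds about `s ^ (-b)` to the distance term, which the mark term of `reach` absorbs.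
In the integrals over `t ≤ s` the powers of `s` otherwise cancel; they converge at zero since `γ + b
< 1`. -/
theorem exists_lintegral_stronger_reach_le (hd : 1 ≤ d) {κ δ γ b : ℝ} (hκ : 0 < κ) (hδ : 1 < δ)
    (hγ₀ : 0 < γ) (hb : 0 < b) (hbd : b * d ≤ 1) (hbδ : b < δ - 1) (hbγ : γ + b < 1) :
    ∃ C : ℝ≥0∞, C ≠ ∞ ∧ ∀ (x : EuclideanSpace ℝ (Fin d)) (a : Vertex d),
      ∫⁻ u, (if u.2 ≤ a.2 then edgeWeight κ δ γ a u * reach b x u else 0) ∂(vertexVolume d)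
        ≤ C * reach b x a := by
  have hδ0 : 0 < δ := by linarith
  obtain ⟨C, hC, h⟩ := exists_lintegral_location_reach_le (γ := γ) hd hκ hδ hb hbd hbδ
  have hγ1 : γ < 1 := by linarith
  have hγb : γ * (1 + b) < 1 := by nlinarith
  set κ₁ := κ ^ (1 / δ)
  set κ₂ := κ ^ ((1 + b) / δ)
  have hκ₁ : 0 < κ₁ := Real.rpow_pos_of_pos hκ _
  have hκ₂ : 0 < κ₂ := Real.rpow_pos_of_pos hκ _
  set c₁ := κ₁ / (1 - γ)
  set c₂ := κ₁ / (1 - (γ + b))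
  set c₃ := κ₂ / (1 - γ * (1 + b))
  have hc₁ : 0 ≤ c₁ := div_nonneg hκ₁.le (by linarith)
  have hc₂ : 0 ≤ c₂ := div_nonneg hκ₁.le (by linarith)
  have hc₃ : 0 ≤ c₃ := div_nonneg hκ₂.le (by linarith)
  refine ⟨C * (ENNReal.ofReal c₁ + ENNReal.ofReal c₂ + ENNReal.ofReal c₃), by finiteness,
    fun x a => ?_⟩
  obtain ⟨y, s⟩ := a
  have hs := s.2.1
  have hmeas : Measurable fun u : Vertex d =>
      (if u.2 ≤ s then edgeWeight κ δ γ (y, s) u * reach b x u else 0) :=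
    Measurable.ite (measurableSet_mark_le measurable_snd measurable_const) (by fun_prop)
      measurable_const
  set X := ENNReal.ofReal ‖x - y‖ ^ (b * d)
  set S₁ : ℝ := κ₁ * (s : ℝ) ^ (γ - 1)
  set S₂ : ℝ := κ₂ * (s : ℝ) ^ ((γ - 1) * (1 + b))
  have hS₁ : 0 ≤ S₁ := by positivity
  have hS₂ : 0 ≤ S₂ := by positivity
  let I : ℝ → Set.Ioo (0 : ℝ) 1 → ℝ≥0∞ := fun e t =>
    if (t : ℝ) ≤ s then ENNReal.ofReal ((t : ℝ) ^ (-e)) else 0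
  have hI : ∀ e, Measurable (I e) := fun e => measurable_mark_ite e s
  have hinner : ∀ t : Set.Ioo (0 : ℝ) 1,
      ∫⁻ z, (if t ≤ s then edgeWeight κ δ γ (y, s) (z, t) * reach b x (z, t) else 0)
      ≤ C * (ENNReal.ofReal S₁ * X * I γ t + ENNReal.ofReal S₁ * I (γ + b) t
          + ENNReal.ofReal S₂ * I (γ * (1 + b)) t) := by
    intro t
    by_cases hts : t ≤ s
    · have hts' : (t : ℝ) ≤ s := hts
      have ht := t.2.1
      simp only [hts, if_true, I, hts']
      refine (h x (y, s) t _ le_rfl).trans ?_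
      rw [rpow_inv_markFactor hδ0 hκ hs ht, rpow_inv_markFactor hδ0 hκ hs ht, min_eq_right hts',
        max_eq_left hts', mul_one, mul_one]
      have e₁ : ENNReal.ofReal (κ₁ * (t : ℝ) ^ (-γ) * (s : ℝ) ^ (γ - 1))
          = ENNReal.ofReal S₁ * ENNReal.ofReal ((t : ℝ) ^ (-γ)) := by
        rw [← ENNReal.ofReal_mul hS₁]; congr 1; simp only [S₁]; ring
      have e₂ : ENNReal.ofReal (κ₂ * (t : ℝ) ^ (-(γ * (1 + b))) * (s : ℝ) ^ ((γ - 1) * (1 + b)))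
          = ENNReal.ofReal S₂ * ENNReal.ofReal ((t : ℝ) ^ (-(γ * (1 + b)))) := by
        rw [← ENNReal.ofReal_mul hS₂]; congr 1; simp only [S₂]; ring
      have e₃ : ENNReal.ofReal ((t : ℝ) ^ (-(γ + b)))
          = ENNReal.ofReal ((t : ℝ) ^ (-γ)) * ENNReal.ofReal ((t : ℝ) ^ (-b)) := by
        rw [← ENNReal.ofReal_mul (by positivity), ← Real.rpow_add ht, neg_add]
      rw [e₁, e₂, e₃]
      refine le_of_eq ?_
      ring
    · simp [hts]
  have hs₁ : S₁ * ((s : ℝ) ^ (1 - γ) / (1 - γ)) = c₁ := by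
    have : (s : ℝ) ^ (γ - 1) * (s : ℝ) ^ (1 - γ) = 1 := by
      rw [← Real.rpow_add hs]; simp
    calc S₁ * ((s : ℝ) ^ (1 - γ) / (1 - γ))
        = κ₁ * ((s : ℝ) ^ (γ - 1) * (s : ℝ) ^ (1 - γ)) / (1 - γ) := by ring
      _ = c₁ := by rw [this, mul_one]
  have hs₂ : S₁ * ((s : ℝ) ^ (1 - (γ + b)) / (1 - (γ + b))) = c₂ * (s : ℝ) ^ (-b) := by
    have : (s : ℝ) ^ (γ - 1) * (s : ℝ) ^ (1 - (γ + b)) = (s : ℝ) ^ (-b) := by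
      rw [← Real.rpow_add hs]; congr 1; ring
    calc _ = κ₁ * ((s : ℝ) ^ (γ - 1) * (s : ℝ) ^ (1 - (γ + b))) / (1 - (γ + b)) := by ring
      _ = _ := by rw [this]; ring
  have hs₃ : S₂ * ((s : ℝ) ^ (1 - γ * (1 + b)) / (1 - γ * (1 + b))) = c₃ * (s : ℝ) ^ (-b) := by
    have : (s : ℝ) ^ ((γ - 1) * (1 + b)) * (s : ℝ) ^ (1 - γ * (1 + b)) = (s : ℝ) ^ (-b) := by
      rw [← Real.rpow_add hs]; congr 1; ring
    calc _ = κ₂ * ((s : ℝ) ^ ((γ - 1) * (1 + b)) * (s : ℝ) ^ (1 - γ * (1 + b)))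
          / (1 - γ * (1 + b)) := by ring
      _ = _ := by rw [this]; ring
  calc _ = ∫⁻ t, ∫⁻ z, (if t ≤ s then edgeWeight κ δ γ (y, s) (z, t) * reach b x (z, t) else 0)
        ∂volume ∂(Measure.comap Subtype.val volume) := by
        rw [vertexVolume, lintegral_prod_symm _ hmeas.aemeasurable]
    _ ≤ ∫⁻ t, C * (ENNReal.ofReal S₁ * X * I γ t + ENNReal.ofReal S₁ * I (γ + b) t
          + ENNReal.ofReal S₂ * I (γ * (1 + b)) t) ∂(Measure.comap Subtype.val volume) :=
        lintegral_mono hinner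
    _ = C * (ENNReal.ofReal S₁ * X * (∫⁻ t, I γ t ∂(Measure.comap Subtype.val volume))
          + ENNReal.ofReal S₁ * (∫⁻ t, I (γ + b) t ∂(Measure.comap Subtype.val volume))
          + ENNReal.ofReal S₂ * ∫⁻ t, I (γ * (1 + b)) t ∂(Measure.comap Subtype.val volume)) := by
        have m₁ := (hI γ).const_mul (ENNReal.ofReal S₁ * X)
        have m₂ := (hI (γ + b)).const_mul (ENNReal.ofReal S₁)
        have m₃ := (hI (γ * (1 + b))).const_mul (ENNReal.ofReal S₂)
        have m₁₂ : Measurable fun t => ENNReal.ofReal S₁ * X * I γ t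
          + ENNReal.ofReal S₁ * I (γ + b) t := m₁.add m₂
        have m₁₂₃ : Measurable fun t => ENNReal.ofReal S₁ * X * I γ t
          + ENNReal.ofReal S₁ * I (γ + b) t + ENNReal.ofReal S₂ * I (γ * (1 + b)) t :=
          m₁₂.add m₃
        rw [lintegral_const_mul _ m₁₂₃, lintegral_add_left m₁₂,
          lintegral_add_left m₁, lintegral_const_mul _ (hI _), lintegral_const_mul _ (hI _),
          lintegral_const_mul _ (hI _)]
    _ ≤ C * (ENNReal.ofReal S₁ * X * ENNReal.ofReal ((s : ℝ) ^ (1 - γ) / (1 - γ))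
          + ENNReal.ofReal S₁ * ENNReal.ofReal ((s : ℝ) ^ (1 - (γ + b)) / (1 - (γ + b)))
          + ENNReal.ofReal S₂
            * ENNReal.ofReal ((s : ℝ) ^ (1 - γ * (1 + b)) / (1 - γ * (1 + b)))) := by
        gcongr
        · exact lintegral_mark_rpow_le hγ1 hs
        · exact lintegral_mark_rpow_le hbγ hs
        · exact lintegral_mark_rpow_le hγb hs
    _ = C * (ENNReal.ofReal c₁ * X + ENNReal.ofReal c₂ * ENNReal.ofReal ((s : ℝ) ^ (-b))
          + ENNReal.ofReal c₃ * ENNReal.ofReal ((s : ℝ) ^ (-b))) := by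
        rw [mul_right_comm, ← ENNReal.ofReal_mul hS₁, ← ENNReal.ofReal_mul hS₁,
          ← ENNReal.ofReal_mul hS₂, hs₁, hs₂, hs₃, ENNReal.ofReal_mul hc₂, ENNReal.ofReal_mul hc₃]
    _ ≤ C * (ENNReal.ofReal c₁ * reach b x (y, s) + ENNReal.ofReal c₂ * reach b x (y, s)
          + ENNReal.ofReal c₃ * reach b x (y, s)) := by
        gcongr
        · exact le_self_add
        · exact le_add_self
        · exact le_add_self
    _ = _ := by ring

/-- The loss in powers of `s` is harmless: the bound serves only the first step, from an endpoint of
fixed mark. -/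
theorem markFactor_le {κ δ γ s t : ℝ} (hκ : 0 < κ) (hδ : 0 < δ) (hγ₀ : 0 < γ) (hγ : γ < 1)
    (hs : 0 < s) (hs1 : s ≤ 1) (ht : 0 < t)
    (ht1 : t ≤ 1) :
    markFactor κ δ γ s t ≤ κ * s ^ (-δ) * t ^ (-(δ * γ)) := by
  have hδγ : 0 < δ * γ := by positivity
  have key : min s t ^ (-(δ * γ)) * max s t ^ (δ * (γ - 1)) ≤ s ^ (-δ) * t ^ (-(δ * γ)) := by
    rcases le_total s t with h | h
    · rw [min_eq_left h, max_eq_right h]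
      calc s ^ (-(δ * γ)) * t ^ (δ * (γ - 1)) ≤ s ^ (-(δ * γ)) * s ^ (δ * (γ - 1)) := by
            gcongr ?_ * ?_
            exact Real.rpow_le_rpow_of_nonpos hs h (by nlinarith)
        _ = s ^ (-δ) * 1 := by rw [← Real.rpow_add hs, mul_one]; congr 1; ring
        _ ≤ _ := by
            gcongr
            exact Real.one_le_rpow_of_pos_of_le_one_of_nonpos ht ht1 (by linarith)
    · rw [min_eq_right h, max_eq_left h]
      have h1 : s ^ (δ * (γ - 1)) = s ^ (-δ) * s ^ (δ * γ) := by
        rw [← Real.rpow_add hs]; congr 1; ring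
      have h2 : s ^ (δ * γ) ≤ 1 := Real.rpow_le_one hs.le hs1 hδγ.le
      rw [h1, mul_comm]
      gcongr
      exact mul_le_of_le_one_right (by positivity) h2
  calc markFactor κ δ γ s t = κ * (min s t ^ (-(δ * γ)) * max s t ^ (δ * (γ - 1))) := by
        rw [markFactor, mul_assoc]
    _ ≤ κ * (s ^ (-δ) * t ^ (-(δ * γ))) := by gcongr
    _ = _ := by ring

/-- This handles the first step of a path, where the endpoint may be stronger or weaker than its
neighbour. The constant may depend on the mark `s` but not on the location. -/
theorem exists_lintegral_reach_le (hd : 1 ≤ d) {κ δ γ b : ℝ} (hκ : 0 < κ) (hδ : 1 < δ)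
    (hγ₀ : 0 < γ) (hb : 0 < b) (hbd : b * d ≤ 1) (hbδ : b < δ - 1) (hbγ : γ + b < 1)
    (s : Set.Ioo (0 : ℝ) 1) :
    ∃ C : ℝ≥0∞, C ≠ ∞ ∧ ∀ x : EuclideanSpace ℝ (Fin d),
      ∫⁻ u, edgeWeight κ δ γ (x, s) u * reach b x u ∂(vertexVolume d) ≤ C := by
  have hd' : (0 : ℝ) < d := by exact_mod_cast hd
  have hδ0 : 0 < δ := by linarith
  have hs := s.2.1
  obtain ⟨C, hC, h⟩ := exists_lintegral_location_reach_le (γ := γ) hd hκ hδ hb hbd hbδ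
  have hγ1 : γ < 1 := by linarith
  have hγb : γ * (1 + b) < 1 := by nlinarith
  set S : ℝ := κ * (s : ℝ) ^ (-δ)
  have hS : 0 < S := by positivity
  let I : ℝ → Set.Ioo (0 : ℝ) 1 → ℝ≥0∞ := fun e t =>
    if (t : ℝ) ≤ 1 then ENNReal.ofReal ((t : ℝ) ^ (-e)) else 0
  have hI : ∀ e, Measurable (I e) := fun e => measurable_mark_ite e 1
  have hIt : ∀ e t, I e t = ENNReal.ofReal ((t : ℝ) ^ (-e)) := fun e t => if_pos t.2.2.le
  have hIi : ∀ e, e < 1 → ∫⁻ t, I e t ∂(Measure.comap Subtype.val volume) ≠ ∞ := fun e he =>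
    ((lintegral_mark_rpow_le he one_pos).trans_lt ENNReal.ofReal_lt_top).ne
  refine ⟨C * (ENNReal.ofReal (S ^ (1 / δ)) * ∫⁻ t, I (γ + b) t ∂(Measure.comap Subtype.val volume)
    + ENNReal.ofReal (S ^ ((1 + b) / δ))
      * ∫⁻ t, I (γ * (1 + b)) t ∂(Measure.comap Subtype.val volume)), ?_, fun x => ?_⟩
  · have := hIi _ hbγ
    have := hIi _ hγb
    finiteness
  have hinner : ∀ t : Set.Ioo (0 : ℝ) 1,
      ∫⁻ z, edgeWeight κ δ γ (x, s) (z, t) * reach b x (z, t)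
      ≤ C * (ENNReal.ofReal (S ^ (1 / δ)) * I (γ + b) t
          + ENNReal.ofReal (S ^ ((1 + b) / δ)) * I (γ * (1 + b)) t) := by
    intro t
    have ht := t.2.1
    refine (h x (x, s) t _ (markFactor_le hκ hδ0 hγ₀ hγ1 hs s.2.2.le ht t.2.2.le)).trans ?_
    have e₁ : ∀ e, (S * (t : ℝ) ^ (-(δ * γ))) ^ (e / δ) = S ^ (e / δ) * (t : ℝ) ^ (-(γ * e)) := by
      intro e
      rw [Real.mul_rpow hS.le (by positivity), ← Real.rpow_mul ht.le]
      congr 2; field_simp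
    rw [e₁, e₁, hIt, hIt, sub_self, norm_zero, ENNReal.ofReal_zero,
      ENNReal.zero_rpow_of_pos (by positivity), mul_zero, zero_add, mul_one,
      ENNReal.ofReal_mul (by positivity), ENNReal.ofReal_mul (by positivity), mul_assoc,
      ← ENNReal.ofReal_mul (by positivity : 0 ≤ (t : ℝ) ^ (-γ)), ← Real.rpow_add ht, neg_add]
  calc _ = ∫⁻ t, ∫⁻ z, edgeWeight κ δ γ (x, s) (z, t) * reach b x (z, t)
        ∂volume ∂(Measure.comap Subtype.val volume) := by
        rw [vertexVolume, lintegral_prod_symm _ (by fun_prop)]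
    _ ≤ ∫⁻ t, C * (ENNReal.ofReal (S ^ (1 / δ)) * I (γ + b) t
          + ENNReal.ofReal (S ^ ((1 + b) / δ)) * I (γ * (1 + b)) t)
            ∂(Measure.comap Subtype.val volume) := lintegral_mono hinner
    _ = _ := by
        have m₁ := (hI (γ + b)).const_mul (ENNReal.ofReal (S ^ (1 / δ)))
        have m₂ := (hI (γ * (1 + b))).const_mul (ENNReal.ofReal (S ^ ((1 + b) / δ)))
        have m₁₂ : Measurable fun t => ENNReal.ofReal (S ^ (1 / δ)) * I (γ + b) t
          + ENNReal.ofReal (S ^ ((1 + b) / δ)) * I (γ * (1 + b)) t := m₁.add m₂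
        rw [lintegral_const_mul _ m₁₂, lintegral_add_left m₁,
          lintegral_const_mul _ (hI _), lintegral_const_mul _ (hI _)]

end Reach

/-! ### Weights of tree-shaped path patterns and their integrals. -/

section TreeWeights

variable {d : ℕ}

/-- The positions of the nodes of a binary tree. -/
def TreeSlot : BinaryTree Unit → Type
  | .nil => Empty
  | .node _ l r => Unit ⊕ (TreeSlot l ⊕ TreeSlot r)

instance TreeSlot.instFintype : ∀ T : BinaryTree Unit, Fintype (TreeSlot T)
  | .nil => inferInstanceAs (Fintype Empty)
  | .node _ l r =>
    letI := TreeSlot.instFintype l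
    letI := TreeSlot.instFintype r
    inferInstanceAs (Fintype (Unit ⊕ (TreeSlot l ⊕ TreeSlot r)))

instance : IsEmpty (TreeSlot .nil) := inferInstanceAs (IsEmpty Empty)

/-- The label of the root. -/
def rootLabel {α : Type*} {i : Unit} {l r : BinaryTree Unit} (x : TreeSlot (.node i l r) → α) : α :=
  x (Sum.inl ())

/-- The labels of the left subtree. -/
def leftLabels {α : Type*} {i : Unit} {l r : BinaryTree Unit} (x : TreeSlot (.node i l r) → α) :
    TreeSlot l → α :=
  fun j => x (Sum.inr (Sum.inl j))

/-- The labels of the right subtree. -/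
def rightLabels {α : Type*} {i : Unit} {l r : BinaryTree Unit} (x : TreeSlot (.node i l r) → α) :
    TreeSlot r → α :=
  fun j => x (Sum.inr (Sum.inr j))

/-- The weight of a path between `a` and `b` through weaker vertices; the tree records recursively
the position of the strongest vertex between two given vertices. -/
noncomputable def innerWeight (κ δ γ : ℝ) : (T : BinaryTree Unit) → Vertex d → Vertex d →
    (TreeSlot T → Vertex d) → ℝ≥0∞
  | .nil, a, b, _ => edgeWeight κ δ γ a b
  | .node _ l r, a, b, x =>
    if (a.2 ≤ (rootLabel x).2 ∧ b.2 ≤ (rootLabel x).2) ∧ edgeFactor κ δ γ a b < 1 then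
      innerWeight κ δ γ l a (rootLabel x) (leftLabels x)
        * innerWeight κ δ γ r (rootLabel x) b (rightLabels x)
    else 0

/-- The weight of a path from `a` to its strongest vertex; the right spine of the tree records
the successive strongest vertices. The weight at the end of the path is `h`. -/
noncomputable def outerWeight (κ δ γ : ℝ) (h : Vertex d → ℝ≥0∞) : (T : BinaryTree Unit) →
    Vertex d → (TreeSlot T → Vertex d) → ℝ≥0∞
  | .nil, a, _ => h a
  | .node _ l r, a, x =>
    if (rootLabel x).2 ≤ a.2 then
      innerWeight κ δ γ l a (rootLabel x) (leftLabels x)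
        * outerWeight κ δ γ h r (rootLabel x) (rightLabels x)
    else 0

theorem measurable_rootLabel {α : Type*} [MeasurableSpace α] {i : Unit} {l r : BinaryTree Unit} :
    Measurable (rootLabel : (TreeSlot (.node i l r) → α) → α) :=
  measurable_pi_apply _

theorem measurable_leftLabels {α : Type*} [MeasurableSpace α] {i : Unit} {l r : BinaryTree Unit} :
    Measurable (leftLabels : (TreeSlot (.node i l r) → α) → TreeSlot l → α) :=
  measurable_pi_lambda _ fun _ => measurable_pi_apply _

theorem measurable_rightLabels {α : Type*} [MeasurableSpace α] {i : Unit} {l r : BinaryTree Unit} :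
    Measurable (rightLabels : (TreeSlot (.node i l r) → α) → TreeSlot r → α) :=
  measurable_pi_lambda _ fun _ => measurable_pi_apply _

theorem measurable_innerWeight {κ δ γ : ℝ} (T : BinaryTree Unit) {α : Type*} [MeasurableSpace α]
    {f g : α → Vertex d} {x : α → TreeSlot T → Vertex d} (hf : Measurable f) (hg : Measurable g)
    (hx : Measurable x) : Measurable fun ω => innerWeight κ δ γ T (f ω) (g ω) (x ω) := by
  induction T generalizing f g with
  | nil => exact measurable_edgeWeight hf hg
  | node i l r ihl ihr =>
    have hu := (measurable_rootLabel (α := Vertex d)).comp hx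
    refine Measurable.ite ?_ ?_ measurable_const
    · exact ((measurableSet_mark_le hf.snd hu.snd).inter (measurableSet_mark_le hg.snd hu.snd)).inter
        (measurableSet_lt (measurable_edgeFactor hf hg) measurable_const)
    · exact (ihl hf hu (measurable_leftLabels.comp hx)).mul
        (ihr hu hg (measurable_rightLabels.comp hx))

theorem measurable_outerWeight {κ δ γ : ℝ} {h : Vertex d → ℝ≥0∞} (hh : Measurable h)
    (T : BinaryTree Unit) {α : Type*} [MeasurableSpace α] {f : α → Vertex d}
    {x : α → TreeSlot T → Vertex d} (hf : Measurable f) (hx : Measurable x) :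
    Measurable fun ω => outerWeight κ δ γ h T (f ω) (x ω) := by
  induction T generalizing f with
  | nil => exact hh.comp hf
  | node i l r _ ihr =>
    have hu := (measurable_rootLabel (α := Vertex d)).comp hx
    refine Measurable.ite (measurableSet_mark_le hu.snd hf.snd) ?_ measurable_const
    exact (measurable_innerWeight l hf hu (measurable_leftLabels.comp hx)).mul
      (ihr hu (measurable_rightLabels.comp hx))

theorem lintegral_pi_sum {ι ι' α : Type*} [Fintype ι] [Fintype ι'] [MeasurableSpace α]
    (μ : Measure α) [SigmaFinite μ] {g : (ι ⊕ ι' → α) → ℝ≥0∞} (hg : Measurable g) :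
    ∫⁻ x, g x ∂(Measure.pi fun _ : ι ⊕ ι' => μ)
      = ∫⁻ y, ∫⁻ z, g (Sum.elim y z) ∂(Measure.pi fun _ : ι' => μ) ∂(Measure.pi fun _ : ι => μ) := by
  have h := (measurePreserving_sumPiEquivProdPi_symm (X := fun _ : ι ⊕ ι' => α) fun _ => μ)
  rw [← h.lintegral_comp_emb (MeasurableEquiv.measurableEmbedding _),
    lintegral_prod (fun p => g ((MeasurableEquiv.sumPiEquivProdPi fun _ : ι ⊕ ι' => α).symm p))
      (hg.comp (MeasurableEquiv.measurable _)).aemeasurable]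
  refine lintegral_congr fun y => lintegral_congr fun z => ?_
  congr 1

theorem lintegral_pi_unit_sum {ι' α : Type*} [Fintype ι'] [MeasurableSpace α]
    (μ : Measure α) [SigmaFinite μ] {g : (Unit ⊕ ι' → α) → ℝ≥0∞} (hg : Measurable g) :
    ∫⁻ x, g x ∂(Measure.pi fun _ : Unit ⊕ ι' => μ)
      = ∫⁻ u, ∫⁻ z, g (Sum.elim (fun _ => u) z) ∂(Measure.pi fun _ : ι' => μ) ∂μ := by
  rw [lintegral_pi_sum μ hg]
  have h := (measurePreserving_funUnique μ Unit).symm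
  rw [← h.lintegral_comp_emb (MeasurableEquiv.measurableEmbedding _)]
  rfl

/-- For a fixed root label the two subtrees involve separate variables, so Tonelli factorises the
integral. Both tree recursions rest on this. -/
theorem lintegral_treeSlot_node {α : Type*} [MeasurableSpace α] (μ : Measure α) [SigmaFinite μ]
    (i : Unit) (l r : BinaryTree Unit)
    {F : α → (TreeSlot l → α) → ℝ≥0∞} {G : α → (TreeSlot r → α) → ℝ≥0∞}
    {S : Set α} [DecidablePred (· ∈ S)] (hS : MeasurableSet S)
    (hF : Measurable F.uncurry) (hG : Measurable G.uncurry) :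
    ∫⁻ x : TreeSlot (.node i l r) → α, (if rootLabel x ∈ S then
      F (rootLabel x) (leftLabels x) * G (rootLabel x) (rightLabels x) else 0)
        ∂(Measure.pi fun _ => μ)
      = ∫⁻ u, (if u ∈ S then (∫⁻ y, F u y ∂(Measure.pi fun _ => μ))
          * ∫⁻ z, G u z ∂(Measure.pi fun _ => μ) else 0) ∂μ := by
  have hm : Measurable fun x : TreeSlot (.node i l r) → α => (if rootLabel x ∈ S then
      F (rootLabel x) (leftLabels x) * G (rootLabel x) (rightLabels x) else 0) :=
    Measurable.ite (measurable_rootLabel hS)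
      ((hF.comp (measurable_rootLabel.prodMk measurable_leftLabels)).mul
        (hG.comp (measurable_rootLabel.prodMk measurable_rightLabels))) measurable_const
  have h1 := lintegral_pi_unit_sum (ι' := TreeSlot l ⊕ TreeSlot r) μ hm
  refine h1.trans (lintegral_congr fun u => ?_)
  by_cases hu : u ∈ S
  · have hFu : Measurable (F u) := hF.comp measurable_prodMk_left
    have hGu : Measurable (G u) := hG.comp measurable_prodMk_left
    have h2 : ∀ z : TreeSlot l ⊕ TreeSlot r → α,
        (if rootLabel (i := i) (Sum.elim (fun _ => u) z) ∈ S then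
          F (rootLabel (i := i) (l := l) (r := r) (Sum.elim (fun _ => u) z))
            (leftLabels (i := i) (l := l) (r := r) (Sum.elim (fun _ => u) z))
          * G (rootLabel (i := i) (l := l) (r := r) (Sum.elim (fun _ => u) z))
            (rightLabels (i := i) (l := l) (r := r) (Sum.elim (fun _ => u) z)) else 0)
        = F u (fun j => z (Sum.inl j)) * G u (fun j => z (Sum.inr j)) := fun z => if_pos hu
    rw [if_pos hu]
    refine (lintegral_congr h2).trans ?_
    rw [lintegral_pi_sum μ (by
      exact (hFu.comp (measurable_pi_lambda _ fun _ => measurable_pi_apply _)).mul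
        (hGu.comp (measurable_pi_lambda _ fun _ => measurable_pi_apply _)))]
    simp only [Sum.elim_inl, Sum.elim_inr]
    rw [lintegral_lintegral_mul hFu.aemeasurable hGu.aemeasurable]
  · rw [if_neg hu]
    refine (lintegral_congr fun z => ?_).trans lintegral_zero
    exact if_neg hu

/-- By induction the two subtrees reduce to single edges through the root, which `hK` turns into
`edgeFactor a b`. The restriction to `edgeFactor a b < 1` in `innerWeight` makes this equal to
`edgeWeight a b`; without it the cap would be lost and the induction would not close. -/
theorem lintegral_innerWeight_le {κ δ γ : ℝ} {K : ℝ≥0∞}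
    (hK : ∀ a b : Vertex d,
      ∫⁻ u, (if a.2 ≤ u.2 ∧ b.2 ≤ u.2 then edgeWeight κ δ γ a u * edgeWeight κ δ γ u b else 0)
        ∂(vertexVolume d) ≤ K * edgeFactor κ δ γ a b)
    (T : BinaryTree Unit) (a b : Vertex d) :
    ∫⁻ x, innerWeight κ δ γ T a b x ∂(Measure.pi fun _ => vertexVolume d)
      ≤ K ^ T.numNodes * edgeWeight κ δ γ a b := by
  classical
  induction T generalizing a b with
  | nil => simp [innerWeight, BinaryTree.numNodes]
  | node i l r ihl ihr =>
    let S : Set (Vertex d) := {u | (a.2 ≤ u.2 ∧ b.2 ≤ u.2) ∧ edgeFactor κ δ γ a b < 1}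
    have hS : MeasurableSet S :=
      ((measurableSet_mark_le measurable_const measurable_snd).inter
        (measurableSet_mark_le measurable_const measurable_snd)).inter (MeasurableSet.const _)
    have h1 := lintegral_treeSlot_node (vertexVolume d) i l r
      (F := fun u y => innerWeight κ δ γ l a u y) (G := fun u z => innerWeight κ δ γ r u b z) hS
      (measurable_innerWeight l measurable_const measurable_fst measurable_snd)
      (measurable_innerWeight r measurable_fst measurable_const measurable_snd)
    have h2 : ∫⁻ x, innerWeight κ δ γ (.node i l r) a b x ∂(Measure.pi fun _ => vertexVolume d)
        = ∫⁻ x : TreeSlot (.node i l r) → Vertex d, (if rootLabel x ∈ S then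
      innerWeight κ δ γ l a (rootLabel x) (leftLabels x)
        * innerWeight κ δ γ r (rootLabel x) b (rightLabels x) else 0)
        ∂(Measure.pi fun _ => vertexVolume d) := by
      refine lintegral_congr fun x => ?_
      simp only [innerWeight, S, Set.mem_ofPred_eq]
    rw [h2, h1]
    by_cases hf : edgeFactor κ δ γ a b < 1
    · have hfw : edgeWeight κ δ γ a b = edgeFactor κ δ γ a b := min_eq_right hf.le
      calc _ ≤ ∫⁻ u, K ^ (l.numNodes + r.numNodes) * (if a.2 ≤ u.2 ∧ b.2 ≤ u.2 then
              edgeWeight κ δ γ a u * edgeWeight κ δ γ u b else 0) ∂(vertexVolume d) := by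
            refine lintegral_mono fun u => ?_
            by_cases hu : a.2 ≤ u.2 ∧ b.2 ≤ u.2
            · simp only [S, Set.mem_ofPred_eq, hf, and_true, hu, and_self, if_true]
              refine (mul_le_mul' (ihl a u) (ihr u b)).trans (le_of_eq ?_)
              ring
            · simp [S, hu]
        _ = K ^ (l.numNodes + r.numNodes) * ∫⁻ u, (if a.2 ≤ u.2 ∧ b.2 ≤ u.2 then
              edgeWeight κ δ γ a u * edgeWeight κ δ γ u b else 0) ∂(vertexVolume d) := by
            refine lintegral_const_mul _ (Measurable.ite ?_ (by fun_prop) measurable_const)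
            exact (measurableSet_mark_le measurable_const measurable_snd).inter
              (measurableSet_mark_le measurable_const measurable_snd)
        _ ≤ K ^ (l.numNodes + r.numNodes) * (K * edgeFactor κ δ γ a b) :=
            mul_le_mul' le_rfl (hK a b)
        _ = _ := by rw [hfw, BinaryTree.numNodes]; ring
    · simp [S, hf]

/-- The excursion through weaker vertices costs no more than one edge, up to powers of `K`; the
remaining step to a stronger vertex is absorbed by the supersolution property `hKh` of `h`. -/
theorem lintegral_outerWeight_le {κ δ γ : ℝ} {K : ℝ≥0∞} {h : Vertex d → ℝ≥0∞} (hh : Measurable h)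
    (hK : ∀ a b : Vertex d,
      ∫⁻ u, (if a.2 ≤ u.2 ∧ b.2 ≤ u.2 then edgeWeight κ δ γ a u * edgeWeight κ δ γ u b else 0)
        ∂(vertexVolume d) ≤ K * edgeFactor κ δ γ a b)
    (hKh : ∀ a : Vertex d, ∫⁻ u, (if u.2 ≤ a.2 then edgeWeight κ δ γ a u * h u else 0)
        ∂(vertexVolume d) ≤ K * h a)
    (T : BinaryTree Unit) (a : Vertex d) :
    ∫⁻ x, outerWeight κ δ γ h T a x ∂(Measure.pi fun _ => vertexVolume d)
      ≤ K ^ T.numNodes * h a := by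
  classical
  induction T generalizing a with
  | nil => simp [outerWeight, BinaryTree.numNodes]
  | node i l r _ ihr =>
    let S : Set (Vertex d) := {u | u.2 ≤ a.2}
    have hS : MeasurableSet S := measurableSet_mark_le measurable_snd measurable_const
    have h1 := lintegral_treeSlot_node (vertexVolume d) i l r
      (F := fun u y => innerWeight κ δ γ l a u y) (G := fun u z => outerWeight κ δ γ h r u z) hS
      (measurable_innerWeight l measurable_const measurable_fst measurable_snd)
      (measurable_outerWeight hh r measurable_fst measurable_snd)
    have h2 : ∫⁻ x, outerWeight κ δ γ h (.node i l r) a x ∂(Measure.pi fun _ => vertexVolume d)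
        = ∫⁻ x : TreeSlot (.node i l r) → Vertex d, (if rootLabel x ∈ S then
      innerWeight κ δ γ l a (rootLabel x) (leftLabels x)
        * outerWeight κ δ γ h r (rootLabel x) (rightLabels x) else 0)
        ∂(Measure.pi fun _ => vertexVolume d) := by
      refine lintegral_congr fun x => ?_
      simp only [outerWeight, S, Set.mem_ofPred_eq]
    rw [h2, h1]
    calc _ ≤ ∫⁻ u, K ^ (l.numNodes + r.numNodes) * (if u.2 ≤ a.2 then
            edgeWeight κ δ γ a u * h u else 0) ∂(vertexVolume d) := by
          refine lintegral_mono fun u => ?_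
          by_cases hu : u.2 ≤ a.2
          · simp only [S, Set.mem_ofPred_eq, hu, if_true]
            refine (mul_le_mul' (lintegral_innerWeight_le hK l a u) (ihr u)).trans (le_of_eq ?_)
            ring
          · simp [S, hu]
      _ = K ^ (l.numNodes + r.numNodes) * ∫⁻ u, (if u.2 ≤ a.2 then
            edgeWeight κ δ γ a u * h u else 0) ∂(vertexVolume d) :=
          lintegral_const_mul _ (Measurable.ite
            (measurableSet_mark_le measurable_snd measurable_const) (by fun_prop) measurable_const)
      _ ≤ K ^ (l.numNodes + r.numNodes) * (K * h a) := mul_le_mul' le_rfl (hKh a)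
      _ = _ := by rw [BinaryTree.numNodes]; ring

end TreeWeights

/-! ### Encoding paths by labelled trees, and probabilities of paths. -/

section Paths

variable {d : ℕ}

/-- The product of the edge weights along the path that starts in `a` and visits `l`. -/
noncomputable def pathWeight (κ δ γ : ℝ) : Vertex d → List (Vertex d) → ℝ≥0∞
  | _, [] => 1
  | a, b :: l => edgeWeight κ δ γ a b * pathWeight κ δ γ b l

theorem pathWeight_append_cons (κ δ γ : ℝ) (a u : Vertex d) (l₁ l₂ : List (Vertex d)) :
    pathWeight κ δ γ a (l₁ ++ u :: l₂)
      = pathWeight κ δ γ a (l₁ ++ [u]) * pathWeight κ δ γ u l₂ := by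
  induction l₁ generalizing a with
  | nil => simp [pathWeight]
  | cons b l ih => simp [pathWeight, ih, mul_assoc]

/-- Non-consecutive vertices of the path have edge factor smaller than one. -/
def NoShortcut (κ δ γ : ℝ) (L : List (Vertex d)) : Prop :=
  ∀ a b l, a :: l ++ [b] <:+: L → l ≠ [] → edgeFactor κ δ γ a b < 1

theorem NoShortcut.infix {κ δ γ : ℝ} {L L' : List (Vertex d)} (h : NoShortcut κ δ γ L)
    (h' : L' <:+: L) : NoShortcut κ δ γ L' :=
  fun a b l hl => h a b l (hl.trans h')

theorem NoShortcut.reverse {κ δ γ : ℝ} {L : List (Vertex d)} (h : NoShortcut κ δ γ L) :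
    NoShortcut κ δ γ L.reverse := by
  intro a b l hl hne
  rw [edgeFactor_comm]
  refine h b a l.reverse ?_ (by simpa using hne)
  have := List.reverse_infix.2 hl
  simpa using this

/-- The labels of a tree in symmetric order. -/
def treeLabels {α : Type*} : (T : BinaryTree Unit) → (TreeSlot T → α) → List α
  | .nil, _ => []
  | .node _ l r, x => treeLabels l (leftLabels x) ++ rootLabel x :: treeLabels r (rightLabels x)

theorem mem_treeLabels {α : Type*} (T : BinaryTree Unit) (x : TreeSlot T → α) (i : TreeSlot T) :
    x i ∈ treeLabels T x := by
  induction T with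
  | nil => exact i.elim
  | node _ l r ihl ihr =>
    rw [treeLabels, List.mem_append, List.mem_cons]
    rcases i with i | i | i
    · exact Or.inr (Or.inl rfl)
    · exact Or.inl (ihl (leftLabels x) i)
    · exact Or.inr (Or.inr (ihr (rightLabels x) i))

theorem length_treeLabels {α : Type*} (T : BinaryTree Unit) (x : TreeSlot T → α) :
    (treeLabels T x).length = T.numNodes := by
  induction T with
  | nil => rfl
  | node _ l r ihl ihr =>
    rw [treeLabels, List.length_append, List.length_cons, ihl, ihr, BinaryTree.numNodes]
    ring

theorem injective_of_nodup_treeLabels {α : Type*} (T : BinaryTree Unit) (x : TreeSlot T → α)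
    (h : (treeLabels T x).Nodup) : Function.Injective x := by
  induction T with
  | nil => exact fun i => i.elim
  | node _ l r ihl ihr =>
    rw [treeLabels, List.nodup_append', List.nodup_cons] at h
    obtain ⟨h1, ⟨h2, h3⟩, h4⟩ := h
    have hl := fun i => mem_treeLabels l (leftLabels x) i
    have hr := fun i => mem_treeLabels r (rightLabels x) i
    have key1 : ∀ i, leftLabels x i ≠ rootLabel x :=
      fun i hi => h4 (hl i) (by rw [hi]; exact List.mem_cons_self)
    have key2 : ∀ i, rightLabels x i ≠ rootLabel x := fun i hi => h2 (hi ▸ hr i)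
    have key3 : ∀ i j, leftLabels x i ≠ rightLabels x j :=
      fun i j hij => h4 (hl i) (List.mem_cons_of_mem _ (hij ▸ hr j))
    rintro (i | i | i) (j | j | j) hij
    · rfl
    · exact absurd hij.symm (key1 j)
    · exact absurd hij.symm (key2 j)
    · exact absurd hij (key1 i)
    · rw [ihl (leftLabels x) h1 hij]
    · exact absurd hij (key3 i j)
    · exact absurd hij (key2 i)
    · exact absurd hij.symm (key3 j i)
    · rw [ihr (rightLabels x) h3 hij]

/-- The labelling of a tree by the labels of its root and of its subtrees. -/
def nodeLabels {α : Type*} {l r : BinaryTree Unit} (u : α) (y : TreeSlot l → α)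
    (z : TreeSlot r → α) : TreeSlot (.node () l r) → α :=
  Sum.elim (fun _ => u) (Sum.elim y z)

/-- Split at a strongest interior vertex, which becomes the root. Both halves inherit the
hypotheses, and the absence of shortcuts supplies the condition on `edgeFactor a b` at each node. -/
theorem exists_innerWeight_eq {κ δ γ : ℝ} (a b : Vertex d) (L : List (Vertex d))
    (hL : NoShortcut κ δ γ (a :: L ++ [b])) (hm : ∀ v ∈ L, a.2 ≤ v.2 ∧ b.2 ≤ v.2) :
    ∃ (T : BinaryTree Unit) (x : TreeSlot T → Vertex d), treeLabels T x = L ∧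
      innerWeight κ δ γ T a b x = pathWeight κ δ γ a (L ++ [b]) := by
  induction hn : L.length using Nat.strong_induction_on generalizing a b L with
  | _ n ih =>
  rcases L.eq_nil_or_concat with rfl | hne
  · exact ⟨.nil, fun i => i.elim, rfl, by simp [innerWeight, pathWeight]⟩
  have hne : L ≠ [] := by rintro rfl; simp at hne
  obtain ⟨u, hu, hmin⟩ : ∃ u ∈ L, ∀ v ∈ L, u.2 ≤ v.2 := by
    obtain ⟨u, hu, h⟩ := L.toFinset.exists_min_image (fun v : Vertex d => v.2)
      (List.toFinset_nonempty_iff _ |>.2 hne)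
    exact ⟨u, by simpa using hu, fun v hv => h v (by simpa using hv)⟩
  obtain ⟨l₁, l₂, rfl⟩ := List.append_of_mem hu
  have hlt : edgeFactor κ δ γ a b < 1 := hL a b _ List.infix_rfl hne
  obtain ⟨T₁, x₁, hx₁, hw₁⟩ := ih l₁.length (by simp at hn; omega) a u l₁
    (hL.infix ⟨[], l₂ ++ [b], by simp⟩)
    (fun v hv => ⟨(hm v (by simp [hv])).1, hmin v (by simp [hv])⟩) rfl
  obtain ⟨T₂, x₂, hx₂, hw₂⟩ := ih l₂.length (by simp at hn; omega) u b l₂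
    (hL.infix ⟨a :: l₁, [], by simp⟩)
    (fun v hv => ⟨hmin v (by simp [hv]), (hm v (by simp [hv])).2⟩) rfl
  refine ⟨.node () T₁ T₂, nodeLabels u x₁ x₂, ?_, ?_⟩
  · show treeLabels T₁ x₁ ++ u :: treeLabels T₂ x₂ = _
    rw [hx₁, hx₂]
  · have h1 : innerWeight κ δ γ (.node () T₁ T₂) a b (nodeLabels u x₁ x₂)
        = if (a.2 ≤ u.2 ∧ b.2 ≤ u.2) ∧ edgeFactor κ δ γ a b < 1 then
            innerWeight κ δ γ T₁ a u x₁ * innerWeight κ δ γ T₂ u b x₂ else 0 := rfl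
    rw [h1, if_pos ⟨hm u hu, hlt⟩, hw₁, hw₂, List.append_assoc, List.cons_append,
      pathWeight_append_cons _ _ _ a u l₁ (l₂ ++ [b])]

theorem exists_outerWeight_eq {κ δ γ : ℝ} (h : Vertex d → ℝ≥0∞) (a : Vertex d)
    (L : List (Vertex d)) (hL : NoShortcut κ δ γ (a :: L))
    (hm : ∀ v ∈ a :: L, ((a :: L).getLast (List.cons_ne_nil _ _)).2 ≤ v.2) :
    ∃ (T : BinaryTree Unit) (x : TreeSlot T → Vertex d), treeLabels T x = L ∧
      outerWeight κ δ γ h T a x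
        = pathWeight κ δ γ a L * h ((a :: L).getLast (List.cons_ne_nil _ _)) := by
  induction hn : L.length using Nat.strong_induction_on generalizing a L with
  | _ n ih =>
  by_cases hne : L = []
  · subst hne
    exact ⟨.nil, fun i => i.elim, rfl, by simp [outerWeight, pathWeight]⟩
  have hlast : (a :: L).getLast (List.cons_ne_nil _ _) = L.getLast hne := List.getLast_cons hne
  -- The next vertex of the right spine is the first one at least as strong as `a`; it exists
  -- because the last vertex is the strongest.
  have hsome : (L.find? fun v => decide (v.2 ≤ a.2)).isSome := by
    rw [List.find?_isSome]
    refine ⟨L.getLast hne, List.getLast_mem hne, ?_⟩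
    have := hm a List.mem_cons_self
    rw [hlast] at this
    simpa using this
  obtain ⟨u, hu⟩ := Option.isSome_iff_exists.1 hsome
  obtain ⟨hua, l₁, l₂, rfl, hl₁⟩ := List.find?_eq_some_iff_append.1 hu
  have hua : u.2 ≤ a.2 := by simpa using hua
  have hl₁ : ∀ v ∈ l₁, a.2 ≤ v.2 := fun v hv => by
    have := hl₁ v hv
    simp only [Bool.not_eq_true', decide_eq_false_iff_not, not_le] at this
    exact this.le
  have hlast' : (a :: (l₁ ++ u :: l₂)).getLast (List.cons_ne_nil _ _)
      = (u :: l₂).getLast (List.cons_ne_nil _ _) := by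
    rw [hlast, List.getLast_append_of_ne_nil _ (List.cons_ne_nil _ _)]
  obtain ⟨T₁, x₁, hx₁, hw₁⟩ := exists_innerWeight_eq a u l₁
    (hL.infix ⟨[], l₂, by simp⟩) (fun v hv => ⟨hl₁ v hv, hua.trans (hl₁ v hv)⟩)
  obtain ⟨T₂, x₂, hx₂, hw₂⟩ := ih l₂.length (by simp at hn; omega) u l₂
    (hL.infix ⟨a :: l₁, [], by simp⟩)
    (fun v hv => by rw [← hlast']; exact hm v (by simp at hv ⊢; tauto)) rfl
  refine ⟨.node () T₁ T₂, nodeLabels u x₁ x₂, ?_, ?_⟩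
  · show treeLabels T₁ x₁ ++ u :: treeLabels T₂ x₂ = _
    rw [hx₁, hx₂]
  · have h1 : outerWeight κ δ γ h (.node () T₁ T₂) a (nodeLabels u x₁ x₂)
        = if u.2 ≤ a.2 then
            innerWeight κ δ γ T₁ a u x₁ * outerWeight κ δ γ h T₂ u x₂ else 0 := rfl
    rw [h1, if_pos hua, hw₁, hw₂, hlast', pathWeight_append_cons _ _ _ a u l₁ l₂, mul_assoc]

/-- The consecutive pairs of the path that starts in `a` and visits `l`. -/
def pathSteps {α : Type*} (a : α) (l : List α) : List (α × α) := (a :: l).zip l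

theorem mem_pathSteps {α : Type*} {a : α} {l : List α} {e : α × α} (he : e ∈ pathSteps a l) :
    ∃ (i : ℕ) (h : i + 1 < (a :: l).length), e = ((a :: l)[i], (a :: l)[i + 1]) := by
  obtain ⟨i, hi, rfl⟩ := List.mem_iff_getElem.1 he
  have hi' : i < l.length := by simpa [pathSteps] using hi
  exact ⟨i, by simpa using hi', by simp [pathSteps]⟩

theorem nodup_pathSteps {α : Type*} {a : α} {l : List α} (h : l.Nodup) : (pathSteps a l).Nodup := by
  refine List.Nodup.of_map Prod.snd ?_
  rw [pathSteps, List.map_snd_zip (by simp)]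
  exact h

theorem pathWeight_eq_prod {κ δ γ : ℝ} (a : Vertex d) (l : List (Vertex d)) :
    pathWeight κ δ γ a l = ((pathSteps a l).map fun e => edgeWeight κ δ γ e.1 e.2).prod := by
  induction l generalizing a with
  | nil => simp [pathWeight, pathSteps]
  | cons b l ih => simp only [pathWeight, ih, pathSteps, List.zip_cons_cons, List.map_cons,
      List.prod_cons]

open Classical in
-- The edge bound is applied only to the steps with factor below one; the others contribute the
-- capped value one. In a simple path each vertex occurs at most once as a start and at most once as
-- an end of a step.
theorem GeometricRandomGraph.EdgeBoundAt.law_path_le {𝒢 : GeometricRandomGraph d} {κ δ γ : ℝ}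
    {η : Configuration d} (h : 𝒢.EdgeBoundAt κ δ γ η) {a : Vertex d} {L : List (Vertex d)}
    (hη : ∀ v ∈ a :: L, v ∈ η.carrier) (hnd : (a :: L).Nodup) :
    𝒢.law η {G | ∀ e ∈ pathSteps a L, G.Adj e.1 e.2 ∨ 1 ≤ edgeFactor κ δ γ e.1 e.2}
      ≤ pathWeight κ δ γ a L := by
  let I : Finset (Vertex d × Vertex d) :=
    (pathSteps a L).toFinset.filter fun e => edgeFactor κ δ γ e.1 e.2 < 1
  have hI : ∀ e ∈ I, e ∈ pathSteps a L := fun e he => by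
    simpa using (Finset.mem_filter.1 he).1
  have hinj : ∀ {i j : ℕ} (hi : i < (a :: L).length) (hj : j < (a :: L).length),
      (a :: L)[i] = (a :: L)[j] → i = j := fun hi hj hij => (hnd.getElem_inj_iff).1 hij
  have hprod : ∏ e ∈ I, edgeFactor κ δ γ e.1 e.2 = pathWeight κ δ γ a L := by
    rw [pathWeight_eq_prod, ← List.prod_toFinset _ (nodup_pathSteps (List.nodup_cons.1 hnd).2),
      Finset.prod_filter]
    refine Finset.prod_congr rfl fun e _ => ?_
    split_ifs with he
    · exact (min_eq_right he.le).symm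
    · exact (min_eq_left (not_lt.1 he)).symm
  rw [← hprod]
  refine (measure_mono ?_).trans (h I ?_ ?_ ?_)
  · intro G hG e he
    exact (hG e (hI e he)).resolve_right (not_le.2 (Finset.mem_filter.1 he).2)
  · intro e he
    obtain ⟨i, hi, rfl⟩ := mem_pathSteps (hI e he)
    exact ⟨hη _ (List.getElem_mem _), hη _ (List.getElem_mem _)⟩
  · intro e he he'
    obtain ⟨i, hi, rfl⟩ := mem_pathSteps (hI e he)
    obtain ⟨j, hj, hij⟩ := mem_pathSteps (hI _ he')
    obtain ⟨h1, h2⟩ := Prod.ext_iff.1 hij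
    have := hinj _ _ h1
    have := hinj _ _ h2
    omega
  · intro v
    have h1 : (I.filter fun e => e.1 = v).card ≤ 1 := by
      refine Finset.card_le_one.2 fun e he f hf => ?_
      obtain ⟨he, hev⟩ := Finset.mem_filter.1 he
      obtain ⟨hf, hfv⟩ := Finset.mem_filter.1 hf
      have hfe := hfv.trans hev.symm
      obtain ⟨i, hi, rfl⟩ := mem_pathSteps (hI e he)
      obtain ⟨j, hj, rfl⟩ := mem_pathSteps (hI f hf)
      have := hinj _ _ hfe
      subst this
      rfl
    have h2 : (I.filter fun e => e.2 = v).card ≤ 1 := by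
      refine Finset.card_le_one.2 fun e he f hf => ?_
      obtain ⟨he, hev⟩ := Finset.mem_filter.1 he
      obtain ⟨hf, hfv⟩ := Finset.mem_filter.1 hf
      have hfe := hfv.trans hev.symm
      obtain ⟨i, hi, rfl⟩ := mem_pathSteps (hI e he)
      obtain ⟨j, hj, rfl⟩ := mem_pathSteps (hI f hf)
      have : j = i := by have := hinj _ _ hfe; omega
      subst this
      rfl
    omega

end Paths

/-! ### Shortcut-free paths and the union bound. -/

section ShortestPaths

variable {d : ℕ}

theorem List.exists_append_of_not_nodup {α : Type*} {L : List α} (h : ¬ L.Nodup) :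
    ∃ A a B C, L = A ++ a :: (B ++ a :: C) := by
  induction L with
  | nil => simp at h
  | cons v L ih =>
    by_cases hv : v ∈ L
    · obtain ⟨B, C, rfl⟩ := List.append_of_mem hv
      exact ⟨[], v, B, C, rfl⟩
    · obtain ⟨A, a, B, C, rfl⟩ := ih fun hL => h (List.nodup_cons.2 ⟨hv, hL⟩)
      exact ⟨v :: A, a, B, C, rfl⟩

/-- Descent on the length: a loop at a repeated element, or the stretch between two related
non-consecutive elements, can be cut out. -/
theorem List.exists_isChain_shortest {α : Type*} {R : α → α → Prop} {x y : α} {L₀ : List α}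
    (h : L₀.IsChain R) (hx : L₀.head? = some x) (hy : L₀.getLast? = some y) :
    ∃ L : List α, L.IsChain R ∧ L.head? = some x ∧ L.getLast? = some y ∧
      L.length ≤ L₀.length ∧ L.Nodup ∧ ∀ a b l, a :: l ++ [b] <:+: L → l ≠ [] → ¬ R a b := by
  induction hn : L₀.length using Nat.strong_induction_on generalizing L₀ with
  | _ n ih =>
  by_cases h1 : L₀.Nodup
  · by_cases h2 : ∀ a b l, a :: l ++ [b] <:+: L₀ → l ≠ [] → ¬ R a b
    · exact ⟨L₀, h, hx, hy, hn.le, h1, h2⟩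
    · push Not at h2
      obtain ⟨a, b, l, ⟨A, C, rfl⟩, hl, hab⟩ := h2
      have e : A ++ (a :: l ++ [b]) ++ C = A ++ a :: (l ++ b :: C) := by simp
      rw [e] at h hx hy hn
      obtain ⟨c1, c2⟩ := List.isChain_split.1 h
      rw [← List.cons_append] at c2
      obtain ⟨-, c3⟩ := List.isChain_split.1 c2
      have hlen : 0 < l.length := List.length_pos_iff.2 hl
      obtain ⟨L, p1, p2, p3, p4, p5⟩ := ih (A ++ a :: b :: C).length
        (by simp at hn ⊢; omega) (L₀ := A ++ a :: b :: C)
        (List.isChain_split.2 ⟨c1, List.isChain_cons_cons.2 ⟨hab, c3⟩⟩)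
        (by rw [← hx]; cases A <;> simp) (by rw [← hy]; simp [List.getLast?_cons]) rfl
      exact ⟨L, p1, p2, p3, p4.trans (by simp at hn ⊢; omega), p5⟩
  · obtain ⟨A, a, B, C, rfl⟩ := List.exists_append_of_not_nodup h1
    obtain ⟨c1, c2⟩ := List.isChain_split.1 h
    rw [← List.cons_append] at c2
    obtain ⟨-, c3⟩ := List.isChain_split.1 c2
    obtain ⟨L, p1, p2, p3, p4, p5⟩ := ih (A ++ a :: C).length
      (by simp at hn ⊢; omega) (L₀ := A ++ a :: C)
      (List.isChain_split.2 ⟨c1, c3⟩)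
      (by rw [← hx]; cases A <;> simp) (by rw [← hy]; simp [List.getLast?_cons]) rfl
    exact ⟨L, p1, p2, p3, p4.trans (by simp at hn ⊢; omega), p5⟩

theorem List.IsChain.forall_mem_tail {α : Type*} {R : α → α → Prop} {a : α} {L : List α}
    (h : (a :: L).IsChain R) {v : α} (hv : v ∈ L) : ∃ u, R u v := by
  induction L generalizing a with
  | nil => simp at hv
  | cons b L ih =>
    obtain ⟨h1, h2⟩ := List.isChain_cons_cons.1 h
    rcases List.mem_cons.1 hv with rfl | hv
    · exact ⟨a, h1⟩
    · exact ih h2 hv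

theorem List.IsChain.forall_mem_pathSteps {α : Type*} {R : α → α → Prop} {a : α} {L : List α}
    (h : (a :: L).IsChain R) {e : α × α} (he : e ∈ pathSteps a L) : R e.1 e.2 := by
  obtain ⟨i, hi, rfl⟩ := mem_pathSteps he
  exact List.isChain_iff_getElem.1 h i hi

/-- The graph `G`, augmented by all pairs of vertices with edge factor at least one. -/
def AugAdj (κ δ γ : ℝ) (G : SimpleGraph (Vertex d)) (u v : Vertex d) : Prop :=
  G.Adj u v ∨ 1 ≤ edgeFactor κ δ γ u v

theorem AugAdj.symm {κ δ γ : ℝ} {G : SimpleGraph (Vertex d)} {u v : Vertex d}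
    (h : AugAdj κ δ γ G u v) : AugAdj κ δ γ G v u :=
  h.imp (fun h => h.symm) fun h => by rwa [edgeFactor_comm]

theorem exists_augmented_geodesic {κ δ γ : ℝ} {G : SimpleGraph (Vertex d)} {η : Configuration d}
    {x y : Vertex d} (hxy : x ≠ y)
    (hG : ∀ u v, G.Adj u v → u ∈ ((η.addPoint x).addPoint y).carrier ∧
      v ∈ ((η.addPoint x).addPoint y).carrier) (w : G.Walk x y) :
    ∃ l : List (Vertex d), l.length ≤ w.length ∧ (x :: (l ++ [y])).Nodup ∧
      (∀ v ∈ l, v ∈ η.carrier) ∧ NoShortcut κ δ γ (x :: (l ++ [y])) ∧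
      (x :: (l ++ [y])).IsChain (AugAdj κ δ γ G) := by
  set E := ((η.addPoint x).addPoint y).carrier with hE
  -- Membership in the vertex set is part of the relation, since pairs with large edge factor exist
  -- outside it; it is read off again from the shortened chain.
  let R : Vertex d → Vertex d → Prop := fun u v => (u ∈ E ∧ v ∈ E) ∧ AugAdj κ δ γ G u v
  have hxE : x ∈ E := Or.inr (Or.inl rfl)
  have h0 : w.support.IsChain R :=
    w.isChain_adj_support.imp fun u v h => ⟨hG u v h, Or.inl h⟩
  obtain ⟨L, c, hx, hy, hlen, hnd, hs⟩ := List.exists_isChain_shortest h0 (x := x) (y := y)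
    (by rw [List.head?_eq_some_head w.support_ne_nil, SimpleGraph.Walk.head_support])
    (by rw [List.getLast?_eq_some_getLast w.support_ne_nil, SimpleGraph.Walk.getLast_support])
  obtain ⟨L', rfl⟩ := List.head?_eq_some_iff.1 hx
  rcases L'.eq_nil_or_concat with rfl | ⟨l, z, rfl⟩
  · simp at hy; exact absurd hy hxy
  rw [List.concat_eq_append] at *
  obtain rfl : z = y := by simpa [List.getLast?_cons] using hy
  have hmem : ∀ v ∈ x :: (l ++ [z]), v ∈ E := by
    intro v hv
    rcases List.mem_cons.1 hv with rfl | hv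
    · exact hxE
    · obtain ⟨u, hu⟩ := c.forall_mem_tail hv
      exact hu.1.2
  refine ⟨l, ?_, hnd, fun v hv => ?_, fun a b l' hl hne => ?_, c.imp fun u v h => h.2⟩
  · simp at hlen; omega
  · have h1 := hmem v (by simp [hv])
    have h2 : v ≠ x := by rintro rfl; simp [hv] at hnd
    have h3 : v ≠ z := by
      rintro rfl
      rw [← List.cons_append, List.nodup_append'] at hnd
      exact hnd.2.2 (List.mem_cons_of_mem _ hv) (by simp)
    rcases h1 with h1 | h1 | h1
    · exact absurd h1 h3
    · exact absurd h1 h2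
    · exact h1
  · by_contra hf
    refine hs a b l' hl hne ⟨⟨hmem a (hl.subset ?_), hmem b (hl.subset ?_)⟩, Or.inr (not_lt.1 hf)⟩
      <;> simp

/-- The paths from `x` through at most `N` points of `η` without shortcuts that end in their
strongest vertex, at distance at least `ρ` from `x`. -/
def farPaths (κ δ γ : ℝ) (η : Configuration d) (x : Vertex d) (N : ℕ) (ρ : ℝ) :
    Set (List (Vertex d)) :=
  {L | L.length ≤ N ∧ (x :: L).Nodup ∧ (∀ v ∈ L, v ∈ η.carrier) ∧ NoShortcut κ δ γ (x :: L) ∧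
    ∃ h : L ≠ [], (∀ v ∈ L, (L.getLast h).2 ≤ v.2) ∧ ρ ≤ ‖x.1 - (L.getLast h).1‖}

theorem mem_farPaths_of_isChain {κ δ γ : ℝ} {G : SimpleGraph (Vertex d)} {η : Configuration d}
    {x z : Vertex d} {N : ℕ} {ρ : ℝ} {l : List (Vertex d)} {L : List (Vertex d)}
    (hl : x :: (l ++ [z]) <:+: L) (hlen : l.length + 1 ≤ N) (hnd : L.Nodup)
    (hη : ∀ v ∈ l ++ [z], v ∈ η.carrier) (hs : NoShortcut κ δ γ L)
    (hc : L.IsChain (AugAdj κ δ γ G)) (hz : ∀ v ∈ l, z.2 ≤ v.2) (hρ : ρ ≤ ‖x.1 - z.1‖) :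
    l ++ [z] ∈ farPaths κ δ γ η x N ρ ∧ (x :: (l ++ [z])).IsChain (AugAdj κ δ γ G) := by
  refine ⟨⟨by simpa using hlen, hnd.sublist hl.sublist, hη, hs.infix hl, by simp, ?_, by simpa⟩,
    hc.infix hl⟩
  intro v hv
  rcases List.mem_append.1 hv with hv | hv
  · simpa using hz v hv
  · obtain rfl : v = z := by simpa using hv
    simp

theorem exists_far_path {κ δ γ : ℝ} {G : SimpleGraph (Vertex d)} {η : Configuration d}
    {x y : Vertex d} (hxy : x ≠ y)
    (hG : ∀ u v, G.Adj u v → u ∈ ((η.addPoint x).addPoint y).carrier ∧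
      v ∈ ((η.addPoint x).addPoint y).carrier) (w : G.Walk x y) {N : ℕ} (hN : w.length ≤ N) :
    AugAdj κ δ γ G x y ∨
      (∃ L ∈ farPaths κ δ γ η x N (‖x.1 - y.1‖ / 2), (x :: L).IsChain (AugAdj κ δ γ G)) ∨
      ∃ L ∈ farPaths κ δ γ η y N (‖x.1 - y.1‖ / 2), (y :: L).IsChain (AugAdj κ δ γ G) := by
  obtain ⟨l, hlen, hnd, hη, hs, hc⟩ := exists_augmented_geodesic (κ := κ) (δ := δ) (γ := γ) hxy hG w
  by_cases hne : l = []
  · subst hne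
    left
    simpa using hc
  right
  obtain ⟨z, hz, hmin⟩ : ∃ u ∈ l, ∀ v ∈ l, u.2 ≤ v.2 := by
    classical
    obtain ⟨u, hu, h⟩ := l.toFinset.exists_min_image (fun v : Vertex d => v.2)
      (List.toFinset_nonempty_iff _ |>.2 hne)
    exact ⟨u, by simpa using hu, fun v hv => h v (by simpa using hv)⟩
  obtain ⟨l₁, l₂, rfl⟩ := List.append_of_mem hz
  have htri : ‖x.1 - y.1‖ ≤ ‖x.1 - z.1‖ + ‖y.1 - z.1‖ := by
    rw [norm_sub_rev y.1 z.1]; exact norm_sub_le_norm_sub_add_norm_sub _ _ _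
  simp only [List.length_append, List.length_cons] at hlen
  rcases le_or_gt (‖x.1 - y.1‖ / 2) ‖x.1 - z.1‖ with h | h
  · refine Or.inl ⟨l₁ ++ [z], mem_farPaths_of_isChain (L := x :: (l₁ ++ z :: l₂ ++ [y]))
      ⟨[], l₂ ++ [y], by simp⟩ (by omega) hnd (fun v hv => hη v ?_) hs hc
      (fun v hv => hmin v (by simp [hv])) h⟩
    simp at hv ⊢; tauto
  -- If `z` is near `x`, it is far from `y`, and the path is read backwards from `y`.
  · refine Or.inr ⟨l₂.reverse ++ [z], mem_farPaths_of_isChain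
      (L := (x :: (l₁ ++ z :: l₂ ++ [y])).reverse)
      ⟨[], l₁.reverse ++ [x], by simp⟩ (by simp; omega) (List.nodup_reverse.2 hnd)
      (fun v hv => hη v ?_) hs.reverse
      (List.isChain_reverse.2 (hc.imp fun u v h => h.symm)) (fun v hv => hmin v ?_) (by linarith)⟩
    · simp at hv ⊢; tauto
    · simp at hv ⊢; tauto

theorem countable_farPaths (κ δ γ : ℝ) (η : Configuration d) (x : Vertex d) (N : ℕ) (ρ : ℝ) :
    (farPaths κ δ γ η x N ρ).Countable := by
  have : Countable η.carrier := η.countable_carrier.to_subtype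
  refine (Set.countable_range fun L : List η.carrier => L.map Subtype.val).mono ?_
  rintro L ⟨-, -, h, -⟩
  lift L to List η.carrier using h
  exact ⟨L, rfl⟩

theorem GeometricRandomGraph.EdgeBoundAt.law_isChain_le {𝒢 : GeometricRandomGraph d} {κ δ γ : ℝ}
    {η : Configuration d} (h : 𝒢.EdgeBoundAt κ δ γ η) {a : Vertex d} {L : List (Vertex d)}
    (hη : ∀ v ∈ a :: L, v ∈ η.carrier) (hnd : (a :: L).Nodup) :
    𝒢.law η {G | (a :: L).IsChain (AugAdj κ δ γ G)} ≤ pathWeight κ δ γ a L := by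
  refine (measure_mono ?_).trans (h.law_path_le hη hnd)
  intro G hG e he
  exact hG.forall_mem_pathSteps he

/-- Union bound over the cases of `exists_far_path`. The families `farPaths` are countable and
depend on the vertices only, so the randomness of the edges enters through single path
probabilities. -/
theorem GeometricRandomGraph.EdgeBoundAt.law_edist_le {𝒢 : GeometricRandomGraph d} {κ δ γ : ℝ}
    {η : Configuration d} {x y : Vertex d} (hxy : x ≠ y)
    (h : 𝒢.EdgeBoundAt κ δ γ ((η.addPoint x).addPoint y)) (N : ℕ) :
    𝒢.law ((η.addPoint x).addPoint y) {G | G.edist x y ≤ N}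
      ≤ edgeFactor κ δ γ x y
        + (∑' L : farPaths κ δ γ η x N (‖x.1 - y.1‖ / 2), pathWeight κ δ γ x L
          + ∑' L : farPaths κ δ γ η y N (‖x.1 - y.1‖ / 2), pathWeight κ δ γ y L) := by
  set η' := (η.addPoint x).addPoint y with hη'
  have hx : x ∈ η'.carrier := Or.inr (Or.inl rfl)
  have hy : y ∈ η'.carrier := Or.inl rfl
  have hsub : ∀ v ∈ η.carrier, v ∈ η'.carrier := fun v hv => Or.inr (Or.inr hv)
  have hunion : ∀ v ∈ η'.carrier,
      𝒢.law η' (⋃ L ∈ farPaths κ δ γ η v N (‖x.1 - y.1‖ / 2),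
        {G | (v :: L).IsChain (AugAdj κ δ γ G)})
      ≤ ∑' L : farPaths κ δ γ η v N (‖x.1 - y.1‖ / 2), pathWeight κ δ γ v L := by
    intro v hv
    refine (measure_biUnion_le _ (countable_farPaths _ _ _ _ _ _ _) _).trans ?_
    refine ENNReal.tsum_le_tsum fun L => ?_
    refine h.law_isChain_le (fun u hu => ?_) L.2.2.1
    rcases List.mem_cons.1 hu with rfl | hu
    · exact hv
    · exact hsub u (L.2.2.2.1 u hu)
  have hdirect : 𝒢.law η' {G | [x, y].IsChain (AugAdj κ δ γ G)} ≤ edgeFactor κ δ γ x y := by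
    refine (h.law_isChain_le (fun u hu => ?_) (by simpa using hxy)).trans ?_
    · simp only [List.mem_cons, List.not_mem_nil, or_false] at hu
      rcases hu with rfl | rfl <;> assumption
    · simpa [pathWeight] using edgeWeight_le_edgeFactor κ δ γ x y
  refine le_trans ?_ (add_le_add hdirect (add_le_add (hunion x hx) (hunion y hy)))
  refine le_trans (measure_mono_ae ?_) ((measure_union_le _ _).trans
    (add_le_add le_rfl (measure_union_le _ _)))
  filter_upwards [𝒢.mem_of_adj η'] with G hG hd
  obtain ⟨w, hw⟩ := SimpleGraph.exists_walk_of_edist_ne_top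
    (ne_top_of_le_ne_top (ENat.natCast_ne_top N) hd)
  have hwN : w.length ≤ N := by
    have : (w.length : ℕ∞) ≤ N := hw.trans_le hd
    exact_mod_cast this
  rcases exists_far_path (κ := κ) (δ := δ) (γ := γ) hxy hG w hwN with h1 | ⟨L, hL, h1⟩ | ⟨L, hL, h1⟩
  · left
    simpa using h1
  · exact Or.inr (Or.inl (Set.mem_biUnion hL h1))
  · exact Or.inr (Or.inr (Set.mem_biUnion hL h1))

end ShortestPaths

/-! ### Counting trees and expected path weights. -/

section FirstMoment

variable {d : ℕ}

/-- The binary trees with at most `N` nodes. -/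
def treesUpTo (N : ℕ) : Finset (BinaryTree Unit) :=
  (Finset.range (N + 1)).biUnion BinaryTree.treesOfNumNodesEq

theorem mem_treesUpTo {N : ℕ} {T : BinaryTree Unit} : T ∈ treesUpTo N ↔ T.numNodes ≤ N := by
  simp [treesUpTo, BinaryTree.mem_treesOfNumNodesEq]

theorem catalan_le_four_pow (n : ℕ) : catalan n ≤ 4 ^ n := by
  rw [catalan_eq_centralBinom_div]
  refine (Nat.div_le_self _ _).trans ?_
  rw [Nat.centralBinom_eq_two_mul_choose]
  refine (Nat.choose_le_two_pow _ _).trans (le_of_eq ?_)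
  rw [pow_mul]; norm_num

/-- Catalan numbers grow at most like `4 ^ k`; the number `N + 1` of sizes is absorbed by `2 ^ N` to
keep a single exponential. -/
theorem sum_treesUpTo_le (K : ℝ≥0∞) (N : ℕ) :
    ∑ T ∈ treesUpTo N, K ^ T.numNodes ≤ (2 * (1 + 4 * K)) ^ N := by
  have hdisj : Set.PairwiseDisjoint (Finset.range (N + 1) : Set ℕ)
      BinaryTree.treesOfNumNodesEq := by
    intro i _ j _ hij
    refine Finset.disjoint_left.2 fun T hi hj => hij ?_
    rw [BinaryTree.mem_treesOfNumNodesEq] at hi hj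
    exact hi.symm.trans hj
  rw [treesUpTo, Finset.sum_biUnion hdisj]
  have hle : ∀ k ∈ Finset.range (N + 1),
      ∑ T ∈ BinaryTree.treesOfNumNodesEq k, K ^ T.numNodes ≤ (1 + 4 * K) ^ N := by
    intro k hk
    calc ∑ T ∈ BinaryTree.treesOfNumNodesEq k, K ^ T.numNodes
        = ∑ T ∈ BinaryTree.treesOfNumNodesEq k, K ^ k :=
          Finset.sum_congr rfl fun T hT => by rw [BinaryTree.mem_treesOfNumNodesEq.1 hT]
      _ = (catalan k : ℝ≥0∞) * K ^ k := by
          rw [Finset.sum_const, BinaryTree.treesOfNumNodesEq_card_eq_catalan, nsmul_eq_mul]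
      _ ≤ 4 ^ k * K ^ k := by
          gcongr
          exact_mod_cast catalan_le_four_pow k
      _ ≤ (1 + 4 * K) ^ k := by
          rw [← mul_pow]
          gcongr
          exact le_add_self
      _ ≤ (1 + 4 * K) ^ N :=
          pow_le_pow_right₀ le_self_add (Nat.lt_succ_iff.1 (Finset.mem_range.1 hk))
  calc _ ≤ ∑ _k ∈ Finset.range (N + 1), (1 + 4 * K) ^ N := Finset.sum_le_sum hle
    _ = ((N + 1 : ℕ) : ℝ≥0∞) * (1 + 4 * K) ^ N := by simp
    _ ≤ 2 ^ N * (1 + 4 * K) ^ N := by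
        gcongr
        exact_mod_cast Nat.lt_two_pow_self
    _ = _ := (mul_pow _ _ _).symm

/-- The weight of the pattern of a far path from `x`. -/
noncomputable def patternWeight (κ δ γ b : ℝ) (x : Vertex d) (T : BinaryTree Unit)
    (ω : Unit ⊕ TreeSlot T → Vertex d) : ℝ≥0∞ :=
  edgeWeight κ δ γ x (ω (Sum.inl ()))
    * outerWeight κ δ γ (reach b x.1) T (ω (Sum.inl ())) fun j => ω (Sum.inr j)

theorem measurable_patternWeight {κ δ γ b : ℝ} (x : Vertex d) (T : BinaryTree Unit) :
    Measurable (patternWeight κ δ γ b x T) := by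
  have h : Measurable fun ω : Unit ⊕ TreeSlot T → Vertex d => ω (Sum.inl ()) :=
    measurable_pi_apply _
  exact (measurable_edgeWeight measurable_const h).mul
    (measurable_outerWeight (measurable_reach measurable_id) T h
      (measurable_pi_lambda _ fun _ => measurable_pi_apply _))

theorem lintegral_patternWeight_le {κ δ γ b : ℝ} {K C : ℝ≥0∞}
    (hK : ∀ a b : Vertex d,
      ∫⁻ u, (if a.2 ≤ u.2 ∧ b.2 ≤ u.2 then edgeWeight κ δ γ a u * edgeWeight κ δ γ u b else 0)
        ∂(vertexVolume d) ≤ K * edgeFactor κ δ γ a b)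
    (hKh : ∀ (x : EuclideanSpace ℝ (Fin d)) (a : Vertex d),
      ∫⁻ u, (if u.2 ≤ a.2 then edgeWeight κ δ γ a u * reach b x u else 0)
        ∂(vertexVolume d) ≤ K * reach b x a)
    {x : Vertex d} (hC : ∫⁻ u, edgeWeight κ δ γ x u * reach b x.1 u ∂(vertexVolume d) ≤ C)
    (T : BinaryTree Unit) :
    ∫⁻ ω, patternWeight κ δ γ b x T ω ∂(Measure.pi fun _ => vertexVolume d)
      ≤ C * K ^ T.numNodes := by
  rw [lintegral_pi_unit_sum _ (measurable_patternWeight x T)]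
  have hm : Measurable (reach b x.1) := measurable_reach measurable_id
  calc _ = ∫⁻ u, edgeWeight κ δ γ x u
          * ∫⁻ z, outerWeight κ δ γ (reach b x.1) T u z ∂(Measure.pi fun _ => vertexVolume d)
          ∂(vertexVolume d) := by
        refine lintegral_congr fun u => ?_
        exact lintegral_const_mul (edgeWeight κ δ γ x u)
          (f := fun z => outerWeight κ δ γ (reach b x.1) T u z)
          (measurable_outerWeight hm T measurable_const measurable_id)
    _ ≤ ∫⁻ u, K ^ T.numNodes * (edgeWeight κ δ γ x u * reach b x.1 u) ∂(vertexVolume d) := by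
        refine lintegral_mono fun u => ?_
        refine (mul_le_mul' le_rfl (lintegral_outerWeight_le hm hK (hKh x.1) T u)).trans
          (le_of_eq ?_)
        ring
    _ = K ^ T.numNodes * ∫⁻ u, edgeWeight κ δ γ x u * reach b x.1 u ∂(vertexVolume d) :=
        lintegral_const_mul _ (by fun_prop)
    _ ≤ K ^ T.numNodes * C := mul_le_mul' le_rfl hC
    _ = _ := mul_comm _ _

theorem exists_pattern_of_mem_farPaths {κ δ γ b : ℝ} (hb : 0 < b) {η : Configuration d}
    {x : Vertex d} {N : ℕ} {ρ : ℝ} {L : List (Vertex d)}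
    (hL : L ∈ farPaths κ δ γ η x N ρ) :
    ∃ T ∈ treesUpTo N, ∃ ω ∈ η.labellings (Unit ⊕ TreeSlot T),
      ω (Sum.inl ()) :: treeLabels T (fun j => ω (Sum.inr j)) = L ∧
      pathWeight κ δ γ x L * ENNReal.ofReal ρ ^ (b * d) ≤ patternWeight κ δ γ b x T ω := by
  obtain ⟨hlen, hnd, hη, hs, hne, hmin, hρ⟩ := hL
  obtain ⟨u, L', rfl⟩ := List.exists_cons_of_ne_nil hne
  obtain ⟨T, lab, hlab, hw⟩ := exists_outerWeight_eq (reach b x.1) u L'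
    (hs.infix ⟨[x], [], by simp⟩) hmin
  rw [List.nodup_cons, List.nodup_cons] at hnd
  refine ⟨T, ?_, Sum.elim (fun _ => u) lab, ⟨?_, ?_⟩, by rw [← hlab]; rfl, ?_⟩
  · rw [mem_treesUpTo, ← length_treeLabels T lab, hlab]
    simp at hlen; omega
  · rw [Sum.elim_injective]
    refine ⟨Function.injective_of_subsingleton _, injective_of_nodup_treeLabels T lab ?_, ?_⟩
    · rw [hlab]; exact hnd.2.2
    · rintro - j rfl
      exact hnd.2.1 (hlab ▸ mem_treeLabels T lab j)
  · rintro (i | i)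
    · exact hη _ List.mem_cons_self
    · exact hη _ (List.mem_cons_of_mem _ (hlab ▸ mem_treeLabels T lab i))
  · show _ ≤ edgeWeight κ δ γ x u * outerWeight κ δ γ (reach b x.1) T u lab
    rw [hw, pathWeight, mul_assoc]
    gcongr
    refine le_trans ?_ le_self_add
    exact ENNReal.rpow_le_rpow (ENNReal.ofReal_le_ofReal hρ) (by positivity)

/-- Markov's inequality: the last vertex is at distance at least `ρ`, so its `reach` is at least `ρ
^ (b * d)`. A path can be recovered from its labelled tree, so no pattern is used twice. -/
theorem tsum_farPaths_le {κ δ γ b : ℝ} (hb : 0 < b) (η : Configuration d) (x : Vertex d) (N : ℕ)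
    {ρ : ℝ} (hρ : 0 < ρ) :
    ∑' L : farPaths κ δ γ η x N ρ, pathWeight κ δ γ x L
      ≤ ENNReal.ofReal (ρ ^ (-(b * d))) * ∑ T ∈ treesUpTo N,
        ∑' ω : η.labellings (Unit ⊕ TreeSlot T), patternWeight κ δ γ b x T ω := by
  choose T hT ω hω hdec hle using fun L : farPaths κ δ γ η x N ρ =>
    exists_pattern_of_mem_farPaths hb L.2
  let J := Σ T : {T // T ∈ treesUpTo N}, η.labellings (Unit ⊕ TreeSlot T.1)
  let Φ : farPaths κ δ γ η x N ρ → J := fun L => ⟨⟨T L, hT L⟩, ⟨ω L, hω L⟩⟩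
  let D : J → List (Vertex d) := fun j => j.2.1 (Sum.inl ()) ::
    treeLabels j.1.1 (fun i => j.2.1 (Sum.inr i))
  have hΦ : Function.Injective Φ := by
    intro L L' h
    have : D (Φ L) = D (Φ L') := by rw [h]
    exact Subtype.ext ((hdec L).symm.trans (this.trans (hdec L')))
  have hρ' : ENNReal.ofReal (ρ ^ (-(b * d))) * ENNReal.ofReal ρ ^ (b * d) = 1 := by
    rw [ENNReal.ofReal_rpow_of_pos hρ, ← ENNReal.ofReal_mul (by positivity), ← Real.rpow_add hρ]
    simp
  calc ∑' L : farPaths κ δ γ η x N ρ, pathWeight κ δ γ x L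
      = ENNReal.ofReal (ρ ^ (-(b * d))) * ∑' L : farPaths κ δ γ η x N ρ,
          pathWeight κ δ γ x L * ENNReal.ofReal ρ ^ (b * d) := by
        rw [ENNReal.tsum_mul_right, mul_left_comm, hρ', mul_one]
    _ ≤ ENNReal.ofReal (ρ ^ (-(b * d))) * ∑' L : farPaths κ δ γ η x N ρ,
          (fun j : J => patternWeight κ δ γ b x j.1.1 j.2.1) (Φ L) := by
        gcongr with L
        exact hle L
    _ ≤ ENNReal.ofReal (ρ ^ (-(b * d))) * ∑' j : J, patternWeight κ δ γ b x j.1.1 j.2.1 := by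
        gcongr
        exact ENNReal.tsum_comp_le_tsum_of_injective hΦ _
    _ = _ := by
        congr 1
        rw [ENNReal.tsum_sigma', tsum_fintype]
        exact Finset.sum_coe_sort (treesUpTo N)
          fun T => ∑' ω : η.labellings (Unit ⊕ TreeSlot T), patternWeight κ δ γ b x T ω

theorem IsUnitPoissonLaw.exists_tsum_farPaths_le {Λ : Measure (Configuration d)}
    (hΛ : IsUnitPoissonLaw Λ) {κ δ γ b : ℝ} (hb : 0 < b) {K C : ℝ≥0∞}
    (hK : ∀ a b : Vertex d,
      ∫⁻ u, (if a.2 ≤ u.2 ∧ b.2 ≤ u.2 then edgeWeight κ δ γ a u * edgeWeight κ δ γ u b else 0)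
        ∂(vertexVolume d) ≤ K * edgeFactor κ δ γ a b)
    (hKh : ∀ (x : EuclideanSpace ℝ (Fin d)) (a : Vertex d),
      ∫⁻ u, (if u.2 ≤ a.2 then edgeWeight κ δ γ a u * reach b x u else 0)
        ∂(vertexVolume d) ≤ K * reach b x a)
    {x : Vertex d} (hC : ∫⁻ u, edgeWeight κ δ γ x u * reach b x.1 u ∂(vertexVolume d) ≤ C)
    (N : ℕ) {ρ : ℝ} (hρ : 0 < ρ) :
    ∃ F : Configuration d → ℝ≥0∞, Measurable F ∧
      (∀ η, ∑' L : farPaths κ δ γ η x N ρ, pathWeight κ δ γ x L ≤ F η) ∧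
      ∫⁻ η, F η ∂Λ ≤ ENNReal.ofReal (ρ ^ (-(b * d))) * (C * (2 * (1 + 4 * K)) ^ N) := by
  choose F hFm hF hFi using fun T : BinaryTree Unit =>
    hΛ.exists_tsum_labellings_le (measurable_patternWeight (κ := κ) (δ := δ) (γ := γ) (b := b) x T)
  refine ⟨fun η => ENNReal.ofReal (ρ ^ (-(b * d))) * ∑ T ∈ treesUpTo N, F T η,
    (Finset.measurable_fun_sum _ fun T _ => hFm T).const_mul _, fun η => ?_, ?_⟩
  · exact (tsum_farPaths_le hb η x N hρ).trans
      (mul_le_mul' le_rfl (Finset.sum_le_sum fun T _ => hF T η))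
  · rw [lintegral_const_mul _ (Finset.measurable_fun_sum _ fun T _ => hFm T),
      lintegral_finsetSum _ fun T _ => hFm T]
    refine mul_le_mul' le_rfl ?_
    calc ∑ T ∈ treesUpTo N, ∫⁻ η, F T η ∂Λ ≤ ∑ T ∈ treesUpTo N, C * K ^ T.numNodes :=
          Finset.sum_le_sum fun T _ => (hFi T).trans (lintegral_patternWeight_le hK hKh hC T)
      _ = C * ∑ T ∈ treesUpTo N, K ^ T.numNodes := by rw [Finset.mul_sum]
      _ ≤ _ := mul_le_mul' le_rfl (sum_treesUpTo_le K N)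

/-- Only subadditivity for `A` and its complement is used, so `A` need not be measurable; the
measurable majorant `F` makes the subtraction under the integral legitimate. -/
theorem one_sub_le_palmProb {Λ : Measure (Configuration d)} [IsProbabilityMeasure Λ]
    {𝒢 : GeometricRandomGraph d} {x y : Vertex d} {A : Set (SimpleGraph (Vertex d))}
    {F : Configuration d → ℝ≥0∞} (hF : Measurable F)
    (h : ∀ᵐ η ∂Λ, 𝒢.law ((η.addPoint x).addPoint y) Aᶜ ≤ F η) :
    1 - ∫⁻ η, F η ∂Λ ≤ 𝒢.palmProb Λ x y A := by
  have := 𝒢.isMarkov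
  calc 1 - ∫⁻ η, F η ∂Λ = ∫⁻ _, 1 ∂Λ - ∫⁻ η, F η ∂Λ := by simp
    _ ≤ ∫⁻ η, (1 - F η) ∂Λ := lintegral_sub_le' _ _ hF.aemeasurable
    _ ≤ 𝒢.palmProb Λ x y A := by
        refine lintegral_mono_ae ?_
        filter_upwards [h] with η hη
        rw [tsub_le_iff_right]
        calc (1 : ℝ≥0∞) = 𝒢.law ((η.addPoint x).addPoint y) (A ∪ Aᶜ) := by
              rw [Set.union_compl_self, measure_univ]
          _ ≤ _ := (measure_union_le _ _).trans (add_le_add le_rfl hη)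

theorem palmProb_le_one {Λ : Measure (Configuration d)} [IsProbabilityMeasure Λ]
    {𝒢 : GeometricRandomGraph d} (x y : Vertex d) (A : Set (SimpleGraph (Vertex d))) :
    𝒢.palmProb Λ x y A ≤ 1 := by
  have := 𝒢.isMarkov
  refine (lintegral_mono fun η => prob_le_one).trans ?_
  simp

end FirstMoment

/-! ### Asymptotics and conclusion. -/

/-- As `log (log r) ^ p` tends to infinity, the exponential factor is eventually at most `r ^ (β /
2)`, half of the available polynomial decay. -/
theorem tendsto_rpow_neg_mul_pow_floor {β B p : ℝ} (hβ : 0 < β) (hB : 1 ≤ B) (hp : 0 < p) :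
    Tendsto (fun r : ℝ => (r / 2) ^ (-β) * B ^ ⌊Real.log r / Real.log (Real.log r) ^ p⌋₊)
      atTop (𝓝 0) := by
  have hlog := Real.tendsto_log_atTop
  have hll : Tendsto (fun r : ℝ => Real.log (Real.log r) ^ p) atTop atTop :=
    (tendsto_rpow_atTop hp).comp (hlog.comp hlog)
  have hlim : Tendsto (fun r : ℝ => 2 ^ β * r ^ (-(β / 2))) atTop (𝓝 0) := by
    simpa using (tendsto_rpow_neg_atTop (half_pos hβ)).const_mul ((2 : ℝ) ^ β)
  have hlB : 0 ≤ Real.log B := Real.log_nonneg hB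
  refine squeeze_zero' ?_ ?_ hlim
  · filter_upwards [eventually_gt_atTop 0] with r hr
    positivity
  · filter_upwards [eventually_gt_atTop 1, hll.eventually_ge_atTop (2 / β * (Real.log B + 1)),
      hll.eventually_gt_atTop 0] with r hr h1 h0
    have hr0 : 0 < r := by linarith
    have hlr : 0 < Real.log r := Real.log_pos hr
    set L := Real.log r / Real.log (Real.log r) ^ p with hL
    have hL0 : 0 ≤ L := div_nonneg hlr.le h0.le
    have h2 : L * Real.log B ≤ β / 2 * Real.log r := by
      have h3 : Real.log B ≤ β / 2 * Real.log (Real.log r) ^ p := by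
        have : β / 2 * (2 / β * (Real.log B + 1)) = Real.log B + 1 := by field_simp
        have := mul_le_mul_of_nonneg_left h1 (half_pos hβ).le
        linarith
      rw [hL, div_mul_eq_mul_div, div_le_iff₀ h0]
      nlinarith
    have h4 : B ^ ⌊L⌋₊ ≤ r ^ (β / 2) := by
      calc B ^ ⌊L⌋₊ = B ^ (⌊L⌋₊ : ℝ) := (Real.rpow_natCast _ _).symm
        _ ≤ B ^ L := Real.rpow_le_rpow_of_exponent_le hB (Nat.floor_le hL0)
        _ = Real.exp (L * Real.log B) := by
            rw [Real.rpow_def_of_pos (by linarith), mul_comm]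
        _ ≤ Real.exp (β / 2 * Real.log r) := Real.exp_le_exp.2 h2
        _ = r ^ (β / 2) := by rw [Real.rpow_def_of_pos hr0, mul_comm]
    calc (r / 2) ^ (-β) * B ^ ⌊L⌋₊ ≤ (r / 2) ^ (-β) * r ^ (β / 2) := by gcongr
      _ = 2 ^ β * (r ^ (-β) * r ^ (β / 2)) := by
          rw [Real.div_rpow hr0.le (by norm_num), Real.rpow_neg (by norm_num : (0 : ℝ) ≤ 2),
            div_inv_eq_mul]
          ring
      _ = 2 ^ β * r ^ (-(β / 2)) := by
          rw [← Real.rpow_add hr0]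
          congr 2; ring

theorem compl_setOf_le_edist_subset {V : Type*} (x y : V) (L : ℝ) :
    {G : SimpleGraph V | ENNReal.ofReal L ≤ ((G.edist x y : ℕ∞) : ℝ≥0∞)}ᶜ
      ⊆ {G | G.edist x y ≤ (⌊L⌋₊ : ℕ)} := by
  intro G hG
  rw [Set.mem_compl_iff, Set.mem_ofPred_eq, not_le] at hG
  rw [Set.mem_ofPred_eq]
  have hne : G.edist x y ≠ ⊤ := by
    intro h
    rw [h] at hG
    simp at hG
  obtain ⟨m, hm⟩ := ENat.ne_top_iff_exists.1 hne
  rw [← hm] at hG ⊢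
  rw [ENat.toENNReal_coe, ← ENNReal.ofReal_natCast, ENNReal.ofReal_lt_ofReal_iff_of_nonneg
    (Nat.cast_nonneg _)] at hG
  exact_mod_cast Nat.le_floor hG.le

theorem proposition2p6 (d : ℕ) (hd : 1 ≤ d) (Λ : Measure (Configuration d))
    (hΛ : IsUnitPoissonLaw Λ) (𝒢 : GeometricRandomGraph d) (δ γ : ℝ) (hδ : 1 < δ) (hγ₀ : 0 < γ)
    (hγ : γ < δ / (δ + 1)) (h𝒢 : 𝒢.EdgeBound Λ δ γ) (p : ℝ) (hp : 1 < p) :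
    ∃ c : ℝ, 0 < c ∧ ∀ s t : Set.Ioo (0 : ℝ) 1,
      Tendsto
        (fun z : EuclideanSpace ℝ (Fin d) × EuclideanSpace ℝ (Fin d) =>
          𝒢.palmProb Λ (z.1, s) (z.2, t)
            {G | ENNReal.ofReal
                (c * (Real.log ‖z.1 - z.2‖ / Real.log (Real.log ‖z.1 - z.2‖) ^ p))
              ≤ ((G.edist (z.1, s) (z.2, t) : ℕ∞) : ℝ≥0∞)})
        (comap (fun z : EuclideanSpace ℝ (Fin d) × EuclideanSpace ℝ (Fin d) => ‖z.1 - z.2‖) atTop)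
        (𝓝 1) := by
  -- The number of steps is `o(log r)`, so the growth rate `B` is irrelevant and `c = 1` serves.
  refine ⟨1, one_pos, fun s t => ?_⟩
  simp only [one_mul]
  have hP := hΛ.isProbabilityMeasure
  have hd' : (0 : ℝ) < d := by exact_mod_cast hd
  obtain ⟨κ, hκ, hedge⟩ := h𝒢
  have hγ1 : γ < 1 := hγ.trans ((div_lt_one (by linarith)).2 (by linarith))
  -- The three bounds give subadditivity of the distance power, the moment of a jump, and
  -- convergence of the mark integrals.
  obtain ⟨b, hb0, hb⟩ : ∃ b : ℝ, 0 < b ∧ b < min (1 / (d : ℝ)) (min (δ - 1) (1 - γ)) :=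
    exists_between (lt_min (by positivity) (lt_min (by linarith) (by linarith)))
  rw [lt_min_iff, lt_min_iff, lt_div_iff₀ hd'] at hb
  obtain ⟨hbd, hbδ, hbγ⟩ := hb
  obtain ⟨K₁, hK₁, h₁⟩ := exists_lintegral_connector_le hd hκ hδ hγ₀ hγ
  obtain ⟨K₂, hK₂, h₂⟩ := exists_lintegral_stronger_reach_le hd hκ hδ hγ₀ hb0 hbd.le hbδ
    (by linarith : γ + b < 1)
  obtain ⟨Cs, hCs, hs⟩ := exists_lintegral_reach_le hd hκ hδ hγ₀ hb0 hbd.le hbδ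
    (by linarith : γ + b < 1) s
  obtain ⟨Ct, hCt, ht⟩ := exists_lintegral_reach_le hd hκ hδ hγ₀ hb0 hbd.le hbδ
    (by linarith : γ + b < 1) t
  set K := K₁ + K₂
  have hK₁' := fun a b : Vertex d => (h₁ a b).trans (mul_le_mul' (le_self_add : K₁ ≤ K) le_rfl)
  have hK₂' := fun x (a : Vertex d) => (h₂ x a).trans (mul_le_mul' (le_add_self : K₂ ≤ K) le_rfl)
  set B := 2 * (1 + 4 * K)
  have hB : B ≠ ∞ := by finiteness
  have hB1 : 1 ≤ B.toReal := by
    rw [← ENNReal.toReal_one]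
    refine ENNReal.toReal_mono hB ?_
    calc (1 : ℝ≥0∞) = 1 * 1 := (one_mul 1).symm
      _ ≤ B := mul_le_mul' (by norm_num) le_self_add
  set β := b * d with hβ
  have hβ0 : 0 < β := by positivity
  let N : ℝ → ℕ := fun r => ⌊Real.log r / Real.log (Real.log r) ^ p⌋₊
  -- The error depends on the locations only through `r`, which gives the uniformity: the first term
  -- is for a direct edge, the second for far paths from either endpoint.
  let err : ℝ → ℝ≥0∞ := fun r => ENNReal.ofReal (markFactor κ δ γ s t * r ^ (-(δ * (d : ℝ))))
    + (Cs + Ct) * ENNReal.ofReal ((r / 2) ^ (-β) * B.toReal ^ N r)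
  have herr : Tendsto err atTop (𝓝 0) := by
    have e₁ : Tendsto (fun r : ℝ => markFactor κ δ γ s t * r ^ (-(δ * (d : ℝ)))) atTop (𝓝 0) := by
      simpa using (tendsto_rpow_neg_atTop (by positivity : 0 < δ * d)).const_mul
        (markFactor κ δ γ s t)
    have e₂ := ENNReal.tendsto_ofReal (tendsto_rpow_neg_mul_pow_floor hβ0 hB1 (by linarith : 0 < p))
    have e₃ := (ENNReal.tendsto_ofReal e₁).add
      (ENNReal.Tendsto.const_mul e₂ (Or.inr (by finiteness : Cs + Ct ≠ ∞)))
    simpa using e₃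
  have hlow : Tendsto (fun z : EuclideanSpace ℝ (Fin d) × EuclideanSpace ℝ (Fin d) =>
      1 - err ‖z.1 - z.2‖) (comap (fun z => ‖z.1 - z.2‖) atTop) (𝓝 1) := by
    have := (ENNReal.Tendsto.sub tendsto_const_nhds herr (Or.inl ENNReal.one_ne_top)).comp
      (tendsto_comap (f := fun z : EuclideanSpace ℝ (Fin d) × EuclideanSpace ℝ (Fin d) =>
        ‖z.1 - z.2‖))
    simpa [Function.comp_def] using this
  refine tendsto_of_tendsto_of_tendsto_of_le_of_le' hlow tendsto_const_nhds ?_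
    (Eventually.of_forall fun z => palmProb_le_one _ _ _)
  filter_upwards [tendsto_comap.eventually (eventually_gt_atTop 0)] with ⟨x, y⟩ hr
  simp only at hr ⊢
  set r := ‖x - y‖
  have hxy : x ≠ y := by
    rintro rfl
    simp [r] at hr
  have hxy' : ((x, s) : Vertex d) ≠ (y, t) := fun h => hxy (congrArg Prod.fst h)
  obtain ⟨F, hFm, hF, hFi⟩ := hΛ.exists_tsum_farPaths_le hb0 hK₁' hK₂' (x := (x, s)) (hs x) (N r)
    (half_pos hr)
  obtain ⟨F', hFm', hF', hFi'⟩ := hΛ.exists_tsum_farPaths_le hb0 hK₁' hK₂' (x := (y, t)) (ht y) (N r)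
    (half_pos hr)
  refine le_trans ?_ (one_sub_le_palmProb
    (F := fun η => edgeFactor κ δ γ ((x, s) : Vertex d) (y, t) + (F η + F' η)) (by fun_prop) ?_)
  · refine tsub_le_tsub_left ?_ 1
    rw [lintegral_add_left measurable_const, lintegral_add_left hFm, lintegral_const, measure_univ,
      mul_one, edgeFactor_eq_ofReal hκ hxy]
    refine add_le_add le_rfl ((add_le_add hFi hFi').trans (le_of_eq ?_))
    rw [ENNReal.ofReal_mul (by positivity), ENNReal.ofReal_pow ENNReal.toReal_nonneg,
      ENNReal.ofReal_toReal hB]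
    ring
  · filter_upwards [hedge (x, s) (y, t)] with η hη
    refine (measure_mono (compl_setOf_le_edist_subset _ _ _)).trans
      ((hη.law_edist_le hxy' _).trans ?_)
    exact add_le_add le_rfl (add_le_add (hF η) (hF' η))
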